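/- Let $\mathbb B=\{0,1\}$ and let $\square$ be a blank symbol. A \emph{tape} is one-way infinite with cells $1,2,3,\dots$, each containing an element of $\mathbb B\cup\{\square\}$, all but finitely many being $\square$, together with a head position. A \emph{basic instruction} $f.p/(q,d)$, with $p:\mathbb B\cup\{\square\}\to\mathbb B$, $q:\mathbb B\cup\{\square\}\to\mathbb B\cup\{\square\}$, $d\in\{-1,0,1\}$, acts on the tape named $f$: if the cell under the head (cell $i$) contains $b$, the reply is $p(b)$, the content becomes $q(b)$, and the head moves to cell $\max(i+d,1)$. On tape $1$, $\mathsf{test}{:}b$ replies $1$ iff the cell under the head contains $b$ and changes nothing, and $\mathsf{set}{:}b{:}d$ writes $b$, moves the head by $d$ and replies $1$. Instruction sequences are built by concatenation $;$ and infinite repetition $(\cdot)^\omega$ from the primitive instructions $a$, $+a$, $-a$ ($a$ a basic instruction), $\#l$ ($l\in\mathbb N$) and $!$. Here $a$ performs $a$ and proceeds with the next instruction; $+a$ performs $a$ and proceeds with the next instruction if the reply is $1$ and otherwise skips it; $-a$ does the same with the roles of the replies exchanged; $\#l$ jumps to the $l$-th next instruction; $!$ terminates; and $\#0$, an infinite chain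 of jumps, or the absence of an instruction to proceed with gives inaction. The thread $|t|$ is the (possibly infinite) behaviour so produced by $t$. For a family $u$ of named tapes, $|t|\mathbin{/}u$ is the thread that results from performing the actions of $|t|$ on the tapes in $u$: each action on an available tape becomes an internal action $\mathsf{tau}$ and its reply selects how to proceed. $|t|\bullet u$ is the family of tapes that results on termination, and the empty family if $|t|$ does not terminate on $u$ or performs an action on a tape that is not available. The depth of a thread is the maximal number of actions (internal ones included) that it can perform. The term $t$ \emph{computes} $F:\mathbb B^*\to\mathbb B$ \emph{in time} $T:\mathbb N\to\mathbb N$ if for some $k\ge 1$ such that $t$ uses only tapes named $1,\dots,k$ the following holds for all $w\in\mathbb B^*$: if $u_w$ is the family of tapes $1,\dots,k$ with $w$ on tape $1$ (starting in cell $1$), all other cells of all tapes blank, and all heads on cell $1$, then $|t|\bullet u_w$ consists of tapes $1,\dots,k$ such that tape $k$ has its head on cell $1$, the bit $F(w)$ in cell $1$ and blanks in all other cells, and the depth of $|t|\mathbin{/}u_w$ is at most $T(|w|)$. A \emph{single-tape Turing-machine program} is a term $(t_1;\dots;t_n)^\omega$, $n\ge1$, where each $t_i$ has the form \[ \begin{aligned}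 &-\mathsf{test}{:}0\,;\,\#3\,;\,\mathsf{set}{:}b_0{:}d_0\,;\,u_0\,;\\ &-\mathsf{test}{:}1\,;\,\#3\,;\,\mathsf{set}{:}b_1{:}d_1\,;\,u_1\,;\\ &-\mathsf{test}{:}\square\,;\,\#3\,;\,\mathsf{set}{:}b_\square{:}d_\square\,;\,u_\square \end{aligned} \] with $b_0,b_1,b_\square\in\mathbb B\cup\{\square\}$, $d_0,d_1,d_\square\in\{-1,0,1\}$, and each of $u_0,u_1,u_\square$ is $\#0$, or $!$, or a jump $\#l$ with $l=12i+9$ for $u_0$, $l=12i+5$ for $u_1$, $l=12i+1$ for $u_\square$, for some $0\le i<n$. Let $\mathbf P$ be the class of all $F:\mathbb B^*\to\mathbb B$ (characteristic functions of languages over $\mathbb B$) that are decided, by accepting if $F(w)=1$ and rejecting if $F(w)=0$, within $T(|w|)$ steps for some polynomial function $T:\mathbb N\to\mathbb N$ by a deterministic Turing machine with a single one-way infinite tape and an arbitrary finite tape alphabet containing $0$, $1$ and $\square$. \textbf{Theorem.} $\mathbf P$ is equal to the class of all functions $F:\mathbb B^*\to\mathbb B$ for which there exist a single-tape Turing-machine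 program $t$ and a polynomial function $T:\mathbb N\to\mathbb N$ such that $t$ computes $F$ in time $T$. -/

import Mathlib

namespace PGA

/-! ## Turing tapes and basic instructions -/

/-- The tape alphabet `{0, 1, □}`: `some b` is the bit `b`, and `none` is the blank `□`. -/
abbrev Sym : Type := Option Bool

/-- The head moves `-1`, `0` and `1`. -/
inductive Dir : Type
  | left
  | stay
  | right

/-- The head position after a move. Cells are numbered from `0`, so a left move on the leftmost
cell leaves the head where it is. -/
def Dir.move : Dir → ℕ → ℕ
  | .left, i => i - 1
  | .stay, i => i
  | .right, i => i + 1

/-- A Turing-tape state: the contents of a one-way infinite tape with finitely many non-blank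
cells, and the head position. Cells are numbered from `0`. -/
@[ext] structure TapeState : Type where
  cells : ℕ → Sym
  head : ℕ
  finite : ∃ j, ∀ k, cells (j + k) = none

/-- The basic instruction `f.p/(q,d)` on the tape named `f`: the reply is `p b`, the content `b`
of the cell under the head is replaced by `q b`, and then the head is moved by `d`. -/
structure BInstr (Φ : Type) : Type where
  focus : Φ
  reply : Sym → Bool
  write : Sym → Sym
  dir : Dir

/-- The state of a tape after carrying out the operation of a basic instruction on it. -/
def TapeState.exec {Φ : Type} (s : TapeState) (a : BInstr Φ) : TapeState where
  cells := Function.update s.cells s.head (a.write (s.cells s.head))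
  head := a.dir.move s.head
  finite := by
    obtain ⟨j, hj⟩ := s.finite
    refine ⟨j + s.head + 1, fun k => ?_⟩
    rw [Function.update_of_ne (by omega)]
    have h := hj (s.head + 1 + k)
    rwa [show j + (s.head + 1 + k) = j + s.head + 1 + k by omega] at h

/-- The tape that holds the string `l` in its first cells and blanks elsewhere, with the head on
the first cell. -/
def TapeState.ofList (l : List Sym) : TapeState where
  cells := fun i => l.getD i none
  head := 0
  finite := ⟨l.length, fun k => by simp⟩

/-- `f.test:b`. -/
def BInstr.test {Φ : Type} (f : Φ) (b : Sym) : BInstr Φ := ⟨f, fun c => decide (c = b), id, .stay⟩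

/-- `f.set:b:d`. -/
def BInstr.set {Φ : Type} (f : Φ) (b : Sym) (d : Dir) : BInstr Φ := ⟨f, fun _ => true, fun _ => b, d⟩

/-! ## Instruction sequences -/

/-- Primitive instructions. -/
inductive PInstr (Φ : Type) : Type
  | plain (a : BInstr Φ)
  | ptst (a : BInstr Φ)
  | ntst (a : BInstr Φ)
  | jmp (l : ℕ)
  | halt

/-- Closed terms of sort instruction sequence: instructions, concatenation and repetition. -/
inductive Term (Φ : Type) : Type
  | instr (u : PInstr Φ)
  | conc (t t' : Term Φ)
  | rep (t : Term Φ)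

/-- Finite and infinite sequences of primitive instructions. -/
inductive InSeq (Φ : Type) : Type
  | fin (l : List (PInstr Φ))
  | inf (s : ℕ → PInstr Φ)

namespace InSeq

variable {Φ : Type}

/-- The instruction at a position (counted from `0`), if there is one. -/
def get : InSeq Φ → ℕ → Option (PInstr Φ)
  | fin l, i => l[i]?
  | inf s, i => some (s i)

def conc : InSeq Φ → InSeq Φ → InSeq Φ
  | fin l, fin l' => fin (l ++ l')
  | fin l, inf s => inf fun i => l.getD i (s (i - l.length))
  | inf s, _ => inf s

/-- Infinite repetition. Only non-empty lists arise from terms, and for those the default value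
`halt` is never used. -/
def rep : InSeq Φ → InSeq Φ
  | fin l => inf fun i => l.getD (i % l.length) .halt
  | inf s => inf s

/-- `JumpsTo s i j`: execution of `s` from position `i` leads, through a finite (possibly empty)
chain of forward jumps `#l` with `l > 0`, to position `j`, where `s` has an instruction that is
not a jump. -/
inductive JumpsTo (s : InSeq Φ) : ℕ → ℕ → Prop
  | here {i : ℕ} {u : PInstr Φ} (h : s.get i = some u) (hu : ∀ l, u ≠ .jmp l) : JumpsTo s i i
  | jump {i j l : ℕ} (h : s.get i = some (.jmp (l + 1))) (hj : JumpsTo s (i + (l + 1)) j) :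
      JumpsTo s i j

open Classical in
/-- The position of the first non-jump instruction that is executed from position `i` on. There is
none after `#0`, after leaving the sequence, and in an infinite chain of jumps. -/
noncomputable def target (s : InSeq Φ) (i : ℕ) : Option ℕ :=
  if h : ∃ j, s.JumpsTo i j then some h.choose else none

end InSeq

namespace Term

variable {Φ : Type}

/-- The instruction sequence represented by a closed term. -/
def seq : Term Φ → InSeq Φ
  | instr u => .fin [u]
  | conc t t' => t.seq.conc t'.seq
  | rep t => t.seq.rep

end Term

/-- All basic instructions in the instruction have a focus in `A`. -/
def PInstr.FociIn {Φ : Type} (A : Set Φ) : PInstr Φ → Prop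
  | plain a => a.focus ∈ A
  | ptst a => a.focus ∈ A
  | ntst a => a.focus ∈ A
  | jmp _ => True
  | halt => True

/-- All foci that occur in the term belong to `A`. -/
def Term.FociIn {Φ : Type} (A : Set Φ) : Term Φ → Prop
  | instr u => u.FociIn A
  | conc t t' => t.FociIn A ∧ t'.FociIn A
  | rep t => t.FociIn A

/-! ## Turing-tape families -/

/-- What a family has under a given name: no tape, an inoperative tape, or a tape in a given
state. -/
inductive Entry : Type
  | absent
  | inoperative
  | operative (s : TapeState)

/-- Turing-tape families. -/
abbrev Family (Φ : Type) : Type := Φ → Entry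

namespace Family

variable {Φ : Type}

def empty : Family Φ := fun _ => .absent

/-- The family with just one tape, which is named `f` and has state `s`. -/
def single [DecidableEq Φ] (f : Φ) (s : TapeState) : Family Φ :=
  Function.update empty f (.operative s)

/-- Composition: two tapes with the same name collapse to an inoperative one. -/
def comp (u v : Family Φ) : Family Φ := fun f =>
  match u f, v f with
  | .absent, e => e
  | e, .absent => e
  | _, _ => .inoperative

/-- The composition of `u 1, …, u n`; the empty family for `n = 0`. -/
def compUpTo (u : ℕ → Family Φ) : ℕ → Family Φ
  | 0 => empty
  | n + 1 => (compUpTo u n).comp (u (n + 1))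

end Family

/-! ## Threads -/

/-- Finite threads: termination, inaction, the internal action followed by a thread, and
postconditional composition `x ⊴ a ⊵ y`, which performs `a` and proceeds as `x` on reply `1` and as
`y` on reply `0`. As the internal action always gives reply `1`, it has one continuation. -/
inductive FinThread (Φ : Type) : Type
  | term
  | dead
  | tau (x : FinThread Φ)
  | pcc (x : FinThread Φ) (a : BInstr Φ) (y : FinThread Φ)

namespace FinThread

variable {Φ : Type}

/-- The projection (approximation up to depth `n`). -/
def proj : ℕ → FinThread Φ → FinThread Φ
  | 0, _ => dead
  | _ + 1, term => term
  | _ + 1, dead => dead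
  | n + 1, tau x => tau (proj n x)
  | n + 1, pcc x a y => pcc (proj n x) a (proj n y)

def depth : FinThread Φ → ℕ
  | term => 0
  | dead => 0
  | tau x => x.depth + 1
  | pcc x _ y => max x.depth y.depth + 1

/-- The use operator on finite threads: every action on an operative tape of the family turns into
the internal action, and the reply selects the continuation. -/
def use [DecidableEq Φ] : FinThread Φ → Family Φ → FinThread Φ
  | term, _ => term
  | dead, _ => dead
  | tau x, u => tau (x.use u)
  | pcc x a y, u =>
    match u a.focus with
    | .absent => pcc (x.use u) a (y.use u)
    | .inoperative => dead
    | .operative s =>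
      tau (if a.reply (s.cells s.head) then x.use (Function.update u a.focus (.operative (s.exec a)))
        else y.use (Function.update u a.focus (.operative (s.exec a))))

/-- The apply operator on finite threads: the family that results on termination, and the empty
family if the thread does not terminate or needs an absent or inoperative tape. -/
def apply [DecidableEq Φ] : FinThread Φ → Family Φ → Family Φ
  | term, u => u
  | dead, _ => Family.empty
  | tau x, u => x.apply u
  | pcc x a y, u =>
    match u a.focus with
    | .absent => Family.empty
    | .inoperative => Family.empty
    | .operative s =>
      if a.reply (s.cells s.head) then x.apply (Function.update u a.focus (.operative (s.exec a)))
      else y.apply (Function.update u a.focus (.operative (s.exec a)))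

theorem proj_use [DecidableEq Φ] (n : ℕ) (x : FinThread Φ) (u : Family Φ) :
    (x.use u).proj n = (x.proj n).use u := by
  induction n generalizing x u with
  | zero => simp [proj, use]
  | succ n ih =>
    cases x with
    | term => simp [proj, use]
    | dead => simp [proj, use]
    | tau x => simp [proj, use, ih]
    | pcc x a y =>
      simp only [proj, use]
      cases u a.focus with
      | absent => simp [proj, ih]
      | inoperative => simp [proj]
      | operative s => simp only [proj]; split <;> simp [ih]

end FinThread

/-- Finite and infinite threads, in the projective limit model: a thread is the sequence of its
projections, so threads with the same projections are equal. -/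
@[ext] structure Thread (Φ : Type) : Type where
  approx : ℕ → FinThread Φ
  coherent : ∀ n, (approx (n + 1)).proj n = approx n

namespace Thread

variable {Φ : Type}

/-- The maximal number of actions that the thread can perform, `⊤` for infinite threads. -/
noncomputable def depth (x : Thread Φ) : ℕ∞ := ⨆ n, ((x.approx n).depth : ℕ∞)

/-- The use operator; it commutes with the projections. -/
def use [DecidableEq Φ] (x : Thread Φ) (u : Family Φ) : Thread Φ where
  approx := fun n => (x.approx n).use u
  coherent := fun n => by rw [FinThread.proj_use, x.coherent]

open Classical in
/-- The apply operator: the eventual value of apply on the projections of the thread. (This value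
always exists; it is the empty family if the thread does not terminate on the family.) -/
noncomputable def apply [DecidableEq Φ] (x : Thread Φ) (u : Family Φ) : Family Φ :=
  if h : ∃ v, ∀ᶠ n in Filter.atTop, (x.approx n).apply u = v then h.choose else Family.empty

end Thread

namespace InSeq

variable {Φ : Type}

/-- The projection up to depth `n` of the thread produced by executing `s` from position `i`. -/
noncomputable def extractApprox (s : InSeq Φ) : ℕ → ℕ → FinThread Φ
  | 0, _ => .dead
  | n + 1, i =>
    match s.target i with
    | none => .dead
    | some j =>
      match s.get j with
      | some (.plain a) => .pcc (extractApprox s n (j + 1)) a (extractApprox s n (j + 1))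
      | some (.ptst a) => .pcc (extractApprox s n (j + 1)) a (extractApprox s n (j + 2))
      | some (.ntst a) => .pcc (extractApprox s n (j + 2)) a (extractApprox s n (j + 1))
      | some .halt => .term
      | some (.jmp _) => .dead
      | none => .dead

theorem proj_extractApprox (s : InSeq Φ) (n i : ℕ) :
    (s.extractApprox (n + 1) i).proj n = s.extractApprox n i := by
  induction n generalizing i with
  | zero => simp [FinThread.proj, extractApprox]
  | succ n ih =>
    rw [extractApprox, extractApprox]
    cases s.target i with
    | none => simp [FinThread.proj]
    | some j =>
      dsimp only
      split <;> simp [FinThread.proj, ih]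

end InSeq

/-- Thread extraction. -/
noncomputable def Term.extract {Φ : Type} (t : Term Φ) : Thread Φ where
  approx := fun n => t.seq.extractApprox n 0
  coherent := fun n => t.seq.proj_extractApprox n 0

/-! ## Computing functions on bit strings

The tapes are named by `1, 2, 3, …`. -/

/-- The family of tapes `1, …, k` with `w₁ □ … □ wₙ` on tape `1`, all other tapes being empty, and
all heads on the first cell. -/
def inputFamily (k : ℕ) {n : ℕ} (w : Fin n → List Bool) : Family ℕ :=
  Family.compUpTo (fun j => Family.single j (TapeState.ofList
    (if j = 1 then [none].intercalate (List.ofFn fun i => (w i).map some) else []))) k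

/-- The term `t` computes the partial function `F` with `k` tapes in time `T`. -/
def ComputesWith (k : ℕ) (t : Term ℕ) {n : ℕ} (F : (Fin n → List Bool) →. List Bool)
    (T : ℕ → ℕ) : Prop :=
  t.FociIn (Set.Icc 1 k) ∧
  (∀ w, ∀ y ∈ F w,
    (∃ s : ℕ → TapeState, t.extract.apply (inputFamily k w) =
      (Family.compUpTo (fun j => Family.single j (s j)) (k - 1)).comp
        (Family.single k (TapeState.ofList (y.map some)))) ∧
    (t.extract.use (inputFamily k w)).depth ≤ T (∑ i, (w i).length)) ∧
  (∀ w, ¬ (F w).Dom → t.extract.apply (inputFamily k w) = Family.empty)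

/-- The term `t` computes the partial function `F` in time `T`. -/
def ComputesInTime (t : Term ℕ) {n : ℕ} (F : (Fin n → List Bool) →. List Bool)
    (T : ℕ → ℕ) : Prop :=
  ∃ k, 1 ≤ k ∧ ComputesWith k t F T

/-- A total function from bit strings to bits as a unary partial function on bit strings. -/
def ofDecision (F : List Bool → Bool) : (Fin 1 → List Bool) →. List Bool :=
  fun w => Part.some [F (w 0)]

/-- The functions from `ℕ` to `ℕ` that are polynomial functions. -/
def poly : Set (ℕ → ℕ) := {T | ∃ p : Polynomial ℝ, ∀ n : ℕ, (T n : ℝ) = p.eval (n : ℝ)}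

/-! ## Single-tape Turing-machine programs -/

/-- The instruction is `#(12 i + c)` with `i < n`, or `#0`, or the termination instruction. -/
def IsExit (n c : ℕ) (u : PInstr ℕ) : Prop :=
  (∃ i < n, u = .jmp (12 * i + c)) ∨ u = .jmp 0 ∨ u = .halt

/-- The twelve instructions of one of the `n` parts of a single-tape Turing-machine program. -/
def IsBlock (n : ℕ) (l : List (PInstr ℕ)) : Prop :=
  ∃ (b₀ b₁ b₂ : Sym) (d₀ d₁ d₂ : Dir) (u₀ u₁ u₂ : PInstr ℕ),
    IsExit n 9 u₀ ∧ IsExit n 5 u₁ ∧ IsExit n 1 u₂ ∧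
    l = [.ntst (.test 1 (some false)), .jmp 3, .plain (.set 1 b₀ d₀), u₀,
         .ntst (.test 1 (some true)), .jmp 3, .plain (.set 1 b₁ d₁), u₁,
         .ntst (.test 1 none), .jmp 3, .plain (.set 1 b₂ d₂), u₂]

/-- The single-tape Turing-machine programs: the terms `(t₁ ; … ; tₙ)^ω` with `n ≥ 1` such that
each `tᵢ` is a block, where concatenations may be bracketed in any way. -/
def TMPrograms : Set (Term ℕ) :=
  {t | ∃ (t' : Term ℕ) (bs : List (List (PInstr ℕ))), t = .rep t' ∧ bs ≠ [] ∧
    (∀ l ∈ bs, IsBlock bs.length l) ∧ t'.seq = .fin bs.flatten}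

/-! ## The complexity class P -/

/-- Deterministic Turing machines with a single one-way infinite tape, an arbitrary finite tape
alphabet `Γ` that contains the bits and a blank, a finite set `Q` of states, and the option not to
move the head. -/
structure TuringMachine : Type 1 where
  Q : Type
  Γ : Type
  finQ : Finite Q
  finΓ : Finite Γ
  bit : Bool → Γ
  blank : Γ
  bit_injective : Function.Injective bit
  bit_ne_blank : ∀ b, bit b ≠ blank
  start : Q
  accept : Q
  reject : Q
  accept_ne_reject : accept ≠ reject
  δ : Q → Γ → Q × Γ × Dir

namespace TuringMachine

structure Cfg (M : TuringMachine) : Type where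
  state : M.Q
  tape : ℕ → M.Γ
  head : ℕ

open Classical in
/-- One step; configurations in the accepting or the rejecting state are final. -/
noncomputable def step (M : TuringMachine) (c : M.Cfg) : M.Cfg :=
  if c.state = M.accept ∨ c.state = M.reject then c
  else
    { state := (M.δ c.state (c.tape c.head)).1
      tape := Function.update c.tape c.head (M.δ c.state (c.tape c.head)).2.1
      head := (M.δ c.state (c.tape c.head)).2.2.move c.head }

/-- The start configuration on an input. -/
def startCfg (M : TuringMachine) (w : List Bool) : M.Cfg where
  state := M.start
  tape := fun i => (w.map M.bit).getD i M.blank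
  head := 0

/-- On each input `w`, after at most `T |w|` steps the machine has accepted if `F w = 1` and has
rejected if `F w = 0`. -/
def DecidesInTime (M : TuringMachine) (F : List Bool → Bool) (T : ℕ → ℕ) : Prop :=
  ∀ w, ∃ m ≤ T w.length,
    (M.step^[m] (M.startCfg w)).state = if F w then M.accept else M.reject

end TuringMachine

/-- The complexity class `P`, languages over `{0, 1}` being given by their characteristic
functions. -/
def ClassP : Set (List Bool → Bool) :=
  {F | ∃ (M : TuringMachine), ∃ T ∈ poly, M.DecidesInTime F T}

end PGA

/-! A program is a finite automaton on one tape over `{0, 1, □}`: a block is a state, its three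
parts are the transitions for the three symbols, and the jumps, read modulo the number of blocks,
select the next state. An automaton step costs between one and four actions (`Implements.advances`).
The upper bound turns fast automata into fast programs (`Implements.of_halts`); the lower bound
turns a bound on the depth of the thread into a bound on the number of automaton steps
(`Implements.halts_or`).

From programs to P, the automaton becomes a Turing machine with one extra step that inspects the
output bit under the head. The output must be on tape `1`, since every other tape stays blank.

From P to programs, the obstacle is the tape alphabet. Symbols of the machine are coded by bit
strings of a fixed length, while `□` serves as delimiter and fills the cells never visited. The
input is converted by carrying one bit at a time past the rest of the input, which takes quadratic
time and leaves `|w| + 1` blanks in front of the codes (`runs_load`). A machine step then takes a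
number of automaton steps that depends only on the code length (`runs_step`). Finally the codes are
erased (`runs_erase`) and the first cell is found without an end marker: on an otherwise blank tape,
a bit written just before a left move is still under the head afterwards only on the first cell
(`halts_probe`). `exists_program` turns the automaton into a program. -/

namespace PGA

/-! ## Automata on a tape over `{0, 1, □}` -/

/-- What an automaton does after writing and moving: proceed with a state, terminate, or become
inactive. -/
inductive Exit (σ : Type) : Type
  | goto (q : σ)
  | halt
  | dead

/-- The map on exits induced by a map on states. -/
def Exit.map {σ τ : Type} (f : σ → τ) : Exit σ → Exit τ
  | goto q => goto (f q)
  | halt => halt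
  | dead => dead

/-- Deterministic automata that operate on one tape over `{0, 1, □}`. -/
abbrev Auto (σ : Type) : Type := σ → Sym → Sym × Dir × Exit σ

/-- `A.Halts k q c h c' h'`: started in state `q` on the tape contents `c` with the head on cell
`h`, the automaton terminates within `k` steps with contents `c'` and the head on cell `h'`. -/
inductive Auto.Halts {σ : Type} (A : Auto σ) :
    ℕ → σ → (ℕ → Sym) → ℕ → (ℕ → Sym) → ℕ → Prop
  | halt {k : ℕ} {q : σ} {c : ℕ → Sym} {h : ℕ} {y : Sym} {d : Dir}
      (e : A q (c h) = (y, d, .halt)) : Halts A (k + 1) q c h (Function.update c h y) (d.move h)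
  | step {k : ℕ} {q q' : σ} {c c' : ℕ → Sym} {h h' : ℕ} {y : Sym} {d : Dir}
      (e : A q (c h) = (y, d, .goto q'))
      (H : Halts A k q' (Function.update c h y) (d.move h) c' h') : Halts A (k + 1) q c h c' h'

/-! ## Threads of infinite instruction sequences -/

namespace InSeq

variable {Φ : Type} {s : ℕ → PInstr Φ}

theorem JumpsTo.unique {s : InSeq Φ} {i j j' : ℕ} (h : s.JumpsTo i j) (h' : s.JumpsTo i j') :
    j = j' := by
  induction h with
  | here h hu =>
    cases h' with
    | here => rfl
    | jump h₁ _ => rw [h] at h₁; cases h₁; exact absurd rfl (hu _)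
  | jump h _ ih =>
    cases h' with
    | here h₁ hu => rw [h] at h₁; cases h₁; exact absurd rfl (hu _)
    | jump h₁ h₂ => rw [h] at h₁; cases h₁; exact ih h₂

/-- `target` is defined by choice; uniqueness of the end of a jump chain lets it be evaluated. -/
theorem target_eq_some {s : InSeq Φ} {i j : ℕ} (h : s.JumpsTo i j) : s.target i = some j := by
  have hex : ∃ j, s.JumpsTo i j := ⟨j, h⟩
  rw [target, dif_pos hex, hex.choose_spec.unique h]

theorem target_jump {s : InSeq Φ} {i l : ℕ} (h : s.get i = some (.jmp (l + 1))) :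
    s.target i = s.target (i + (l + 1)) := by
  by_cases hex : ∃ j, s.JumpsTo (i + (l + 1)) j
  · obtain ⟨j, hj⟩ := hex
    rw [target_eq_some hj, target_eq_some (.jump h hj)]
  · rw [target, target, dif_neg hex, dif_neg]
    rintro ⟨j, hj⟩
    cases hj with
    | here h₁ hu => rw [h] at h₁; cases h₁; exact hu _ rfl
    | jump h₁ h₂ => rw [h] at h₁; cases h₁; exact hex ⟨j, h₂⟩

theorem target_jump_zero {s : InSeq Φ} {i : ℕ} (h : s.get i = some (.jmp 0)) :
    s.target i = none := by
  rw [target, dif_neg]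
  rintro ⟨j, hj⟩
  cases hj with
  | here h₁ hu => rw [h] at h₁; cases h₁; exact hu _ rfl
  | jump h₁ h₂ => rw [h] at h₁; cases h₁

/-- Jumps are not actions, so they leave the depth `n` of the projection unchanged. -/
theorem extractApprox_jump {i l : ℕ} (h : s i = .jmp (l + 1)) (n : ℕ) :
    (inf s).extractApprox n i = (inf s).extractApprox n (i + (l + 1)) := by
  cases n with
  | zero => rfl
  | succ n => rw [extractApprox, extractApprox, target_jump (by rw [get, h])]

theorem extractApprox_jump_zero {i : ℕ} (h : s i = .jmp 0) (n : ℕ) :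
    (inf s).extractApprox n i = .dead := by
  cases n with
  | zero => rfl
  | succ n => rw [extractApprox, target_jump_zero (by rw [get, h])]

theorem target_of_ne_jmp {i : ℕ} (h : ∀ l, s i ≠ .jmp l) : (inf s).target i = some i :=
  target_eq_some (.here rfl h)

theorem extractApprox_halt {i : ℕ} (h : s i = .halt) (n : ℕ) :
    (inf s).extractApprox (n + 1) i = .term := by
  simp [extractApprox, target_of_ne_jmp (s := s) (i := i) (by simp [h]), get, h]

theorem extractApprox_plain {i : ℕ} {a : BInstr Φ} (h : s i = .plain a) (n : ℕ) :
    (inf s).extractApprox (n + 1) i =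
      .pcc ((inf s).extractApprox n (i + 1)) a ((inf s).extractApprox n (i + 1)) := by
  simp [extractApprox, target_of_ne_jmp (s := s) (i := i) (by simp [h]), get, h]

theorem extractApprox_ntst {i : ℕ} {a : BInstr Φ} (h : s i = .ntst a) (n : ℕ) :
    (inf s).extractApprox (n + 1) i =
      .pcc ((inf s).extractApprox n (i + 2)) a ((inf s).extractApprox n (i + 1)) := by
  simp [extractApprox, target_of_ne_jmp (s := s) (i := i) (by simp [h]), get, h]

/-- Each action uses up one unit of `n`. This covers projections too short to complete an automaton
step, about which `Advances` says nothing. -/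
theorem depth_use_extractApprox_le [DecidableEq Φ] (s : InSeq Φ) (n i : ℕ) (u : Family Φ) :
    ((s.extractApprox n i).use u).depth ≤ n := by
  induction n generalizing i u with
  | zero => simp [extractApprox, FinThread.use, FinThread.depth]
  | succ n ih =>
    have key : ∀ i j a, ((FinThread.pcc (s.extractApprox n i) a (s.extractApprox n j)).use u).depth
        ≤ n + 1 := by
      intro i j a
      rw [FinThread.use]
      cases u a.focus with
      | absent => simp [FinThread.depth, ih]
      | inoperative => simp [FinThread.depth]
      | operative t => dsimp only; split <;> simp [FinThread.depth, ih]
    rw [extractApprox]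
    cases s.target i with
    | none => simp [FinThread.use, FinThread.depth]
    | some j =>
      dsimp only
      split <;> first | exact key _ _ _ | simp [FinThread.use, FinThread.depth]

/-- Execution of `s` from position `p` on the family `u` performs `c` actions, which lead to
position `p'` and the family `u'`. -/
def Advances [DecidableEq Φ] (s : ℕ → PInstr Φ) (c p : ℕ) (u : Family Φ) (p' : ℕ)
    (u' : Family Φ) : Prop :=
  ∀ n, (((inf s).extractApprox (n + c) p).use u).depth =
      (((inf s).extractApprox n p').use u').depth + c ∧
    ((inf s).extractApprox (n + c) p).apply u = ((inf s).extractApprox n p').apply u'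

theorem Advances.trans [DecidableEq Φ] {c c' p p' p'' : ℕ} {u u' u'' : Family Φ}
    (h : Advances s c p u p' u') (h' : Advances s c' p' u' p'' u'') :
    Advances s (c' + c) p u p'' u'' := by
  intro n
  rw [← add_assoc, (h _).1, (h _).2, (h' n).1, (h' n).2]
  exact ⟨by omega, rfl⟩

end InSeq

theorem TapeState.exec_test {Φ : Type} (t : TapeState) (f : Φ) (b : Sym) :
    t.exec (.test f b) = t := by
  ext1
  · simp [TapeState.exec, BInstr.test]
  · rfl

/-! ## Instruction sequences that implement automata -/

/-- The position, within a block, of the part that deals with a given symbol. -/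
def offset : Sym → ℕ
  | some false => 0
  | some true => 4
  | none => 8

/-- The instruction `u` at position `p` realizes the exit `e`, where state `q` is realized by the
block that starts at position `12 q`. -/
def Realizes (p : ℕ) (u : PInstr ℕ) : Exit ℕ → Prop
  | .goto q => ∃ l, u = .jmp (l + 1) ∧ p + (l + 1) = 12 * q
  | .halt => u = .halt
  | .dead => u = .jmp 0

/-- The instruction sequence `s` consists of blocks of twelve instructions, where the block at
position `12 m` implements the state `m` of `A`. -/
def Implements (s : ℕ → PInstr ℕ) (A : Auto ℕ) : Prop :=
  ∀ m b, s (12 * m + offset b) = .ntst (.test 1 b) ∧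
    s (12 * m + offset b + 1) = .jmp 3 ∧
    s (12 * m + offset b + 2) = .plain (.set 1 (A m b).1 (A m b).2.1) ∧
    Realizes (12 * m + offset b + 3) (s (12 * m + offset b + 3)) (A m b).2.2

section

open InSeq

variable {s : ℕ → PInstr ℕ} {A : Auto ℕ}

/-- Reply `1` to a negative test skips the `#3` that follows. -/
theorem advances_test_pos {p : ℕ} {t : TapeState} (u : Family ℕ)
    (h : s p = .ntst (.test 1 (t.cells t.head))) :
    Advances s 1 p (Function.update u 1 (.operative t)) (p + 2)
      (Function.update u 1 (.operative t)) := by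
  intro n
  rw [extractApprox_ntst h]
  simp only [FinThread.use, FinThread.apply]
  have hf : Function.update u 1 (.operative t)
      (BInstr.test 1 (t.cells t.head)).focus = .operative t := by
    simp [BInstr.test]
  simp only [hf]
  simp [TapeState.exec_test]
  simp [BInstr.test, FinThread.depth]

/-- Reply `0` leads to the `#3` at `p + 1`, which lands on the next part of the block at no cost. -/
theorem advances_test_neg {p : ℕ} {t : TapeState} {b : Sym} (u : Family ℕ)
    (h : s p = .ntst (.test 1 b)) (h' : s (p + 1) = .jmp 3) (hb : t.cells t.head ≠ b) :
    Advances s 1 p (Function.update u 1 (.operative t)) (p + 4)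
      (Function.update u 1 (.operative t)) := by
  intro n
  rw [extractApprox_ntst h, extractApprox_jump h']
  simp only [FinThread.use, FinThread.apply]
  have hf : Function.update u 1 (.operative t) (BInstr.test 1 b).focus = .operative t := by
    simp [BInstr.test]
  simp only [hf]
  simp [TapeState.exec_test]
  simp [BInstr.test, FinThread.depth, hb]

theorem advances_set {p : ℕ} {t : TapeState} {y : Sym} {d : Dir} (u : Family ℕ)
    (h : s p = .plain (.set 1 y d)) :
    Advances s 1 p (Function.update u 1 (.operative t)) (p + 1)
      (Function.update u 1 (.operative (t.exec (BInstr.set 1 y d)))) := by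
  intro n
  rw [extractApprox_plain h]
  simp only [FinThread.use, FinThread.apply]
  have hf : Function.update u 1 (.operative t) (BInstr.set 1 y d).focus = .operative t := by
    simp [BInstr.set]
  simp only [hf]
  simp [BInstr.set, FinThread.depth]

/-- One step of an implemented automaton takes at least one and at most four actions. -/
theorem Implements.advances (hs : Implements s A) (m : ℕ) (t : TapeState) (u : Family ℕ) :
    ∃ c, 1 ≤ c ∧ c ≤ 4 ∧
      Advances s c (12 * m) (Function.update u 1 (.operative t))
        (12 * m + offset (t.cells t.head) + 3)
        (Function.update u 1 (.operative (t.exec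
          (BInstr.set 1 (A m (t.cells t.head)).1 (A m (t.cells t.head)).2.1)))) := by
  have main : ∀ b, t.cells t.head = b →
      Advances s 2 (12 * m + offset b) (Function.update u 1 (.operative t))
        (12 * m + offset b + 3)
        (Function.update u 1 (.operative (t.exec (BInstr.set 1 (A m b).1 (A m b).2.1)))) := by
    rintro b rfl
    obtain ⟨h₀, -, h₂, -⟩ := hs m (t.cells t.head)
    exact (advances_test_pos u h₀).trans (advances_set u h₂)
  have neg : ∀ b, t.cells t.head ≠ b →
      Advances s 1 (12 * m + offset b) (Function.update u 1 (.operative t))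
        (12 * m + offset b + 4) (Function.update u 1 (.operative t)) := fun b hb =>
    advances_test_neg u (hs m b).1 (hs m b).2.1 hb
  -- The symbols are tested in the order `0`, `1`, `□`; each failed test adds one action to the
  -- successful test and the write.
  rcases hb : t.cells t.head with _ | _ | _
  · exact ⟨4, by omega, by omega,
      ((neg (some false) (by simp [hb])).trans (neg (some true) (by simp [hb]))).trans
        (main _ hb)⟩
  · exact ⟨2, by omega, by omega, main _ hb⟩
  · exact ⟨3, by omega, by omega, (neg (some false) (by simp [hb])).trans (main _ hb)⟩

theorem TapeState.exec_set (t : TapeState) (y : Sym) (d : Dir) :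
    (t.exec (BInstr.set 1 y d : BInstr ℕ)).cells = Function.update t.cells t.head y ∧
      (t.exec (BInstr.set 1 y d : BInstr ℕ)).head = d.move t.head :=
  ⟨rfl, rfl⟩

/-- If an implemented automaton terminates within `k` steps, then the instruction sequence
terminates within `4 k` actions and produces the same tape. -/
theorem Implements.of_halts (hs : Implements s A) (u : Family ℕ) {k m : ℕ} {c c' : ℕ → Sym}
    {h h' : ℕ} (H : A.Halts k m c h c' h') (t : TapeState) (hc : t.cells = c) (hh : t.head = h) :
    ∃ t' : TapeState, t'.cells = c' ∧ t'.head = h' ∧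
      (∀ n, (((inf s).extractApprox n (12 * m)).use
        (Function.update u 1 (.operative t))).depth ≤ 4 * k) ∧
      ∀ n, 4 * k + 1 ≤ n → ((inf s).extractApprox n (12 * m)).apply
        (Function.update u 1 (.operative t)) = Function.update u 1 (.operative t') := by
  induction H generalizing t with
  | @halt k q c h y d e =>
    subst hc hh
    obtain ⟨c, -, hc4, hadv⟩ := hs.advances q t u
    have hr := (hs q (t.cells t.head)).2.2.2
    rw [e] at hadv hr
    refine ⟨_, (t.exec_set y d).1, (t.exec_set y d).2, fun n => ?_, fun n hn => ?_⟩
    · rcases lt_or_ge n c with hn | hn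
      · exact (depth_use_extractApprox_le _ _ _ _).trans (by omega)
      · obtain ⟨n, rfl⟩ := Nat.exists_eq_add_of_le' hn
        rw [(hadv n).1]
        cases n with
        | zero => simp [extractApprox, FinThread.use, FinThread.depth]; omega
        | succ n => simp [extractApprox_halt hr, FinThread.use, FinThread.depth]; omega
    -- Beyond the `c` actions, one more unit of depth is needed for the projection to show
    -- termination instead of inaction; hence the `+ 1` in `4 * k + 1`.
    · obtain ⟨n, rfl⟩ := Nat.exists_eq_add_of_le' (show c + 1 ≤ n by omega)
      rw [show n + (c + 1) = n + 1 + c by omega, (hadv _).2, extractApprox_halt hr]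
      rfl
  | @step k q q' c c' h h' y d e H ih =>
    subst hc hh
    obtain ⟨c, -, hc4, hadv⟩ := hs.advances q t u
    have hr := (hs q (t.cells t.head)).2.2.2
    rw [e] at hadv hr
    obtain ⟨l, hl, hlq⟩ := hr
    obtain ⟨t', h₁, h₂, h₃, h₄⟩ := ih _ (t.exec_set y d).1 (t.exec_set y d).2
    refine ⟨t', h₁, h₂, fun n => ?_, fun n hn => ?_⟩
    · rcases lt_or_ge n c with hn | hn
      · exact (depth_use_extractApprox_le _ _ _ _).trans (by omega)
      · obtain ⟨n, rfl⟩ := Nat.exists_eq_add_of_le' hn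
        rw [(hadv n).1, extractApprox_jump hl, hlq]
        have := h₃ n
        dsimp only
        omega
    · obtain ⟨n, rfl⟩ := Nat.exists_eq_add_of_le' (show c ≤ n by omega)
      rw [(hadv _).2, extractApprox_jump hl, hlq]
      exact h₄ _ (by omega)

/-- An implemented automaton terminates within `k` steps, or the instruction sequence reaches
inaction, or the instruction sequence performs more than `k` actions. -/
theorem Implements.halts_or (hs : Implements s A) (u : Family ℕ) (k m : ℕ) (t : TapeState) :
    (∃ c' h', A.Halts k m t.cells t.head c' h') ∨
      (∀ᶠ n in Filter.atTop, ((inf s).extractApprox n (12 * m)).apply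
        (Function.update u 1 (.operative t)) = Family.empty) ∨
      ∃ n, k < (((inf s).extractApprox n (12 * m)).use
        (Function.update u 1 (.operative t))).depth := by
  induction k generalizing m t with
  | zero =>
    obtain ⟨c, hc, -, hadv⟩ := hs.advances m t u
    -- Any step performs at least one action, so the depth already exceeds zero.
    refine .inr (.inr ⟨0 + c, ?_⟩)
    rw [(hadv 0).1]
    omega
  | succ k ih =>
    obtain ⟨c, hc, -, hadv⟩ := hs.advances m t u
    have hr := (hs m (t.cells t.head)).2.2.2
    rcases e : A m (t.cells t.head) with ⟨y, d, q | _ | _⟩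
    · rw [e] at hadv hr
      obtain ⟨l, hl, hlq⟩ := hr
      rcases ih q (t.exec (BInstr.set 1 y d : BInstr ℕ)) with ⟨c', h', H⟩ | H | ⟨n, hn⟩
      · exact .inl ⟨c', h', .step e H⟩
      · refine .inr (.inl ?_)
        filter_upwards [(Filter.tendsto_sub_atTop_nat c).eventually H,
          Filter.eventually_ge_atTop c] with n hn hcn
        rw [← Nat.sub_add_cancel hcn, (hadv _).2, extractApprox_jump hl, hlq]
        exact hn
      · refine .inr (.inr ⟨n + c, ?_⟩)
        rw [(hadv _).1, extractApprox_jump hl, hlq]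
        dsimp only
        omega
    · exact .inl ⟨_, _, .halt e⟩
    · rw [e] at hadv hr
      refine .inr (.inl ?_)
      filter_upwards [Filter.eventually_ge_atTop c] with n hcn
      rw [← Nat.sub_add_cancel hcn, (hadv _).2, extractApprox_jump_zero hr]
      rfl

end

/-- Two eventual values agree at a common index, so the chosen one is the given one. -/
theorem Thread.apply_eq {Φ : Type} [DecidableEq Φ] {x : Thread Φ} {u v : Family Φ}
    (h : ∀ᶠ n in Filter.atTop, (x.approx n).apply u = v) : x.apply u = v := by
  have hex : ∃ v, ∀ᶠ n in Filter.atTop, (x.approx n).apply u = v := ⟨v, h⟩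
  rw [Thread.apply, dif_pos hex]
  obtain ⟨n, h₁, h₂⟩ := (hex.choose_spec.and h).exists
  rw [← h₁, h₂]

/-! ## Single-tape Turing-machine programs as automata -/

/-- The behaviour of one block: what to write, where to move and how to proceed for each symbol,
where `goto j` stands for the start of the `j`-th block after the next one. -/
abbrev BlockSpec : Type := Sym → Sym × Dir × Exit ℕ

/-- The instruction with which a part of a block is left. -/
def exitInstr (c : ℕ) : Exit ℕ → PInstr ℕ
  | .goto j => .jmp (12 * j + c)
  | .halt => .halt
  | .dead => .jmp 0

/-- The twelve instructions of a block. -/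
def BlockSpec.code (E : BlockSpec) : List (PInstr ℕ) :=
  [.ntst (.test 1 (some false)), .jmp 3, .plain (.set 1 (E (some false)).1 (E (some false)).2.1),
    exitInstr 9 (E (some false)).2.2,
   .ntst (.test 1 (some true)), .jmp 3, .plain (.set 1 (E (some true)).1 (E (some true)).2.1),
    exitInstr 5 (E (some true)).2.2,
   .ntst (.test 1 none), .jmp 3, .plain (.set 1 (E none).1 (E none).2.1),
    exitInstr 1 (E none).2.2]

theorem BlockSpec.length_code (E : BlockSpec) : E.code.length = 12 := rfl

/-- All relative jumps go less than `n` blocks beyond the next block. -/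
def BlockSpec.Bounded (n : ℕ) (E : BlockSpec) : Prop :=
  ∀ b j, (E b).2.2 = .goto j → j < n

/-- The bound on the jump can be dropped here, since targets are later reduced modulo the number of
blocks. -/
theorem IsExit.exists_exit {n c : ℕ} {u : PInstr ℕ} (h : IsExit n c u) :
    ∃ e : Exit ℕ, u = exitInstr c e := by
  rcases h with ⟨i, -, rfl⟩ | rfl | rfl
  exacts [⟨.goto i, rfl⟩, ⟨.dead, rfl⟩, ⟨.halt, rfl⟩]

theorem IsBlock.exists_spec {n : ℕ} {l : List (PInstr ℕ)} (h : IsBlock n l) :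
    ∃ E : BlockSpec, l = E.code := by
  obtain ⟨b₀, b₁, b₂, d₀, d₁, d₂, u₀, u₁, u₂, h₀, h₁, h₂, rfl⟩ := h
  obtain ⟨e₀, rfl⟩ := h₀.exists_exit
  obtain ⟨e₁, rfl⟩ := h₁.exists_exit
  obtain ⟨e₂, rfl⟩ := h₂.exists_exit
  exact ⟨fun
    | some false => (b₀, d₀, e₀)
    | some true => (b₁, d₁, e₁)
    | none => (b₂, d₂, e₂), rfl⟩

theorem isExit_exitInstr {n c : ℕ} {e : Exit ℕ} (h : ∀ j, e = .goto j → j < n) :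
    IsExit n c (exitInstr c e) := by
  cases e with
  | goto j => exact .inl ⟨j, h j rfl, rfl⟩
  | halt => exact .inr (.inr rfl)
  | dead => exact .inr (.inl rfl)

theorem BlockSpec.Bounded.isBlock {n : ℕ} {E : BlockSpec} (h : E.Bounded n) :
    IsBlock n E.code :=
  ⟨_, _, _, _, _, _, _, _, _, isExit_exitInstr (h _), isExit_exitInstr (h _),
    isExit_exitInstr (h _), rfl⟩

/-- The automaton of the infinite repetition of the given blocks, where the blocks are numbered
consecutively. -/
def unroll (es : List BlockSpec) : Auto ℕ := fun m b =>
  let x := es.getD (m % es.length) (fun _ => (none, .stay, .dead)) b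
  (x.1, x.2.1, x.2.2.map (m + 1 + ·))

theorem getElem?_flatten_code (es : List BlockSpec) (i r : ℕ) (hi : i < es.length) (hr : r < 12) :
    (es.map BlockSpec.code).flatten[12 * i + r]? =
      (es.getD i (fun _ => (none, .stay, .dead))).code[r]? := by
  induction es generalizing i with
  | nil => simp at hi
  | cons E es ih =>
    cases i with
    | zero =>
      rw [List.map_cons, List.flatten_cons,
        List.getElem?_append_left (by rw [BlockSpec.length_code]; omega)]
      simp
    | succ i =>
      rw [List.map_cons, List.flatten_cons,
        List.getElem?_append_right (by rw [BlockSpec.length_code]; omega),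
        BlockSpec.length_code, show 12 * (i + 1) + r - 12 = 12 * i + r by omega,
        ih i (by simpa using hi)]
      simp

theorem length_flatten_code (es : List BlockSpec) :
    (es.map BlockSpec.code).flatten.length = 12 * es.length := by
  induction es with
  | nil => rfl
  | cons E es ih => simp [ih, BlockSpec.length_code]; omega

/-- The instruction sequence of the infinite repetition of the given blocks. -/
def programSeq (es : List BlockSpec) (i : ℕ) : PInstr ℕ :=
  (es.map BlockSpec.code).flatten.getD (i % (es.map BlockSpec.code).flatten.length) .halt

theorem implements_programSeq {es : List BlockSpec} (hes : es ≠ []) :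
    Implements (programSeq es) (unroll es) := by
  have hn : 0 < es.length := List.length_pos_iff.2 hes
  have key : ∀ m r, r < 12 → programSeq es (12 * m + r) =
      (es.getD (m % es.length) (fun _ => (none, .stay, .dead))).code.getD r .halt := by
    intro m r hr
    -- The period is a multiple of twelve, so reduction keeps the place within the block.
    have hmod : (12 * m + r) % (12 * es.length) = 12 * (m % es.length) + r := by
      have h₁ := Nat.mod_add_div m es.length
      have h₂ : m % es.length < es.length := Nat.mod_lt _ hn
      rw [show 12 * m + r = 12 * (m % es.length) + r + 12 * es.length * (m / es.length) by
        rw [mul_assoc]; omega, Nat.add_mul_mod_self_left, Nat.mod_eq_of_lt (by omega)]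
    rw [programSeq, length_flatten_code, hmod, List.getD_eq_getElem?_getD,
      getElem?_flatten_code _ _ _ (Nat.mod_lt _ hn) hr, ← List.getD_eq_getElem?_getD]
  -- `c` is the distance from the exit instruction to the end of its block, so a jump by `12 * j +
  -- c` starts the `j`-th block after the next one.
  have real : ∀ (m b c) (e : Exit ℕ), offset b + 3 + c = 12 →
      Realizes (12 * m + offset b + 3) (exitInstr c e) (e.map (m + 1 + ·)) := by
    intro m b c e hc
    cases e with
    | goto j =>
      have : 0 < c := by rcases b with _ | _ | _ <;> simp only [offset] at hc <;> omega
      exact ⟨12 * j + c - 1, by rw [exitInstr, Nat.sub_add_cancel (by omega)], by dsimp only; omega⟩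
    | halt => rfl
    | dead => rfl
  intro m b
  have ho : offset b ≤ 8 := by rcases b with _ | _ | _ <;> simp [offset]
  simp only [add_assoc]
  rw [key _ _ (by omega), key _ _ (by omega), key _ _ (by omega), key _ _ (by omega)]
  simp only [← add_assoc]
  rcases b with _ | _ | _
  · exact ⟨rfl, rfl, rfl, real m none 1 _ rfl⟩
  · exact ⟨rfl, rfl, rfl, real m (some false) 9 _ rfl⟩
  · exact ⟨rfl, rfl, rfl, real m (some true) 5 _ rfl⟩

theorem exists_specs_of_mem_TMPrograms {t : Term ℕ} (h : t ∈ TMPrograms) :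
    ∃ es : List BlockSpec, es ≠ [] ∧ t.seq = .inf (programSeq es) := by
  obtain ⟨t', bs, rfl, hbs, hb, hseq⟩ := h
  have : ∀ l ∈ bs, ∃ E : BlockSpec, l = E.code := fun l hl => (hb l hl).exists_spec
  have hex : ∃ es : List BlockSpec, bs = es.map BlockSpec.code := by
    clear hbs hb hseq
    induction bs with
    | nil => exact ⟨[], rfl⟩
    | cons l bs ih =>
      obtain ⟨E, rfl⟩ := this l (by simp)
      obtain ⟨es, rfl⟩ := ih fun l hl => this l (by simp [hl])
      exact ⟨E :: es, rfl⟩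
  obtain ⟨es, rfl⟩ := hex
  exact ⟨es, by simpa using hbs, by rw [Term.seq, hseq]; rfl⟩

/-- The concatenation of a list of instructions. -/
def Term.ofList {Φ : Type} : List (PInstr Φ) → Term Φ
  | [] => .instr .halt
  | [u] => .instr u
  | u :: v :: l => .conc (.instr u) (Term.ofList (v :: l))

theorem Term.seq_ofList {Φ : Type} {l : List (PInstr Φ)} (hl : l ≠ []) :
    (Term.ofList l).seq = .fin l := by
  induction l with
  | nil => exact absurd rfl hl
  | cons u l ih =>
    cases l with
    | nil => rfl
    | cons v l => rw [Term.ofList, Term.seq, ih (by simp)]; rfl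

theorem Term.fociIn_ofList {Φ : Type} {A : Set Φ} {l : List (PInstr Φ)}
    (h : ∀ u ∈ l, u.FociIn A) : (Term.ofList l).FociIn A := by
  induction l with
  | nil => trivial
  | cons u l ih =>
    cases l with
    | nil => exact h u (by simp)
    | cons v l => exact ⟨h u (by simp), ih fun w hw => h w (by simp [hw])⟩

theorem exists_mem_TMPrograms {es : List BlockSpec} (hes : es ≠ [])
    (hb : ∀ E ∈ es, E.Bounded es.length) :
    ∃ t ∈ TMPrograms, t.seq = .inf (programSeq es) ∧ t.FociIn (Set.Icc 1 1) := by
  have hne : (es.map BlockSpec.code).flatten ≠ [] := by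
    rw [← List.length_pos_iff, length_flatten_code]
    have := List.length_pos_iff.2 hes
    omega
  refine ⟨.rep (.ofList (es.map BlockSpec.code).flatten), ⟨_, es.map BlockSpec.code, rfl,
    by simpa using hes, ?_, Term.seq_ofList hne⟩, ?_, ?_⟩
  · intro l hl
    obtain ⟨E, hE, rfl⟩ := List.mem_map.1 hl
    simpa using (hb E hE).isBlock
  · rw [Term.seq, Term.seq_ofList hne]
    rfl
  · refine Term.fociIn_ofList fun u hu => ?_
    obtain ⟨l, hl, hu⟩ := List.mem_flatten.1 hu
    obtain ⟨E, -, rfl⟩ := List.mem_map.1 hl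
    have hexit : ∀ c e, (exitInstr c e).FociIn (Set.Icc 1 1) := by
      intro c e
      cases e <;> trivial
    simp only [BlockSpec.code, List.mem_cons, List.not_mem_nil, or_false] at hu
    rcases hu with rfl | rfl | rfl | rfl | rfl | rfl | rfl | rfl | rfl | rfl | rfl | rfl <;>
      first | exact hexit _ _ | simp [PInstr.FociIn, BInstr.test, BInstr.set]

/-! ## Families of consecutively numbered tapes -/

/-- The names are distinct, so no two tapes collapse to an inoperative one. -/
theorem compUpTo_single (s : ℕ → TapeState) (k f : ℕ) :
    Family.compUpTo (fun j => Family.single j (s j)) k f =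
      if 1 ≤ f ∧ f ≤ k then .operative (s f) else .absent := by
  induction k with
  | zero => rw [if_neg (by omega)]; rfl
  | succ k ih =>
    rw [Family.compUpTo, Family.comp, ih]
    by_cases hf : f = k + 1
    · subst hf
      simp [Family.single]
    · rw [Family.single, Function.update_of_ne hf]
      by_cases h : 1 ≤ f ∧ f ≤ k
      · rw [if_pos h, if_pos (by omega)]; rfl
      · rw [if_neg h, if_neg (by omega)]; rfl

theorem inputFamily_apply (k : ℕ) (w : Fin 1 → List Bool) (f : ℕ) :
    inputFamily k w f = if 1 ≤ f ∧ f ≤ k then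
      .operative (TapeState.ofList (if f = 1 then (w 0).map some else [])) else .absent := by
  rw [inputFamily, compUpTo_single fun j => TapeState.ofList
    (if j = 1 then [none].intercalate (List.ofFn fun i => (w i).map some) else [])]
  simp

theorem outputFamily_apply (s : ℕ → TapeState) {k : ℕ} (hk : 1 ≤ k) (t : TapeState) :
    (Family.compUpTo (fun j => Family.single j (s j)) (k - 1)).comp (Family.single k t) k =
      .operative t := by
  rw [Family.comp, compUpTo_single, if_neg (by omega)]
  simp [Family.single]

/-! ## From programs to Turing machines -/

/-- The Turing machine that simulates the infinite repetition of the given blocks. In the state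
`Sum.inr none` it accepts or rejects according to the symbol under the head. -/
def machineOf (es : List BlockSpec) (hes : es ≠ []) : TuringMachine where
  Q := Fin es.length ⊕ Option Bool
  Γ := Sym
  finQ := inferInstance
  finΓ := inferInstance
  bit := some
  blank := none
  bit_injective := Option.some_injective _
  bit_ne_blank := by simp
  start := .inl ⟨0, List.length_pos_iff.2 hes⟩
  accept := .inr (some true)
  reject := .inr (some false)
  accept_ne_reject := by simp
  δ := fun
    | .inl i, b => (match (unroll es i b).2.2 with
        | .goto m => .inl ⟨m % es.length, Nat.mod_lt _ (List.length_pos_iff.2 hes)⟩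
        | .halt => .inr none
        | .dead => .inr (some false), (unroll es i b).1, (unroll es i b).2.1)
    | .inr _, b => (.inr (some (decide (b = some true))), b, .stay)

/-- States of `unroll` are positions in the infinite sequence and only increase, so its periodicity
holds for the next states merely modulo the number of blocks. -/
theorem unroll_mod (es : List BlockSpec) (m : ℕ) (b : Sym) :
    (unroll es m b).1 = (unroll es (m % es.length) b).1 ∧
    (unroll es m b).2.1 = (unroll es (m % es.length) b).2.1 ∧
    (unroll es m b).2.2.map (· % es.length) =
      (unroll es (m % es.length) b).2.2.map (· % es.length) := by
  simp only [unroll, Nat.mod_mod, true_and]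
  cases (es.getD (m % es.length) (fun _ => (none, .stay, .dead)) b).2.2 with
  | goto j => simp [Exit.map, Nat.add_mod]
  | halt => rfl
  | dead => rfl

theorem machineOf_step (es : List BlockSpec) (hes : es ≠ []) (m : ℕ) (c : ℕ → Sym) (h : ℕ) :
    (machineOf es hes).step
        ⟨.inl ⟨m % es.length, Nat.mod_lt _ (List.length_pos_iff.2 hes)⟩, c, h⟩ =
      ⟨match (unroll es m (c h)).2.2 with
        | .goto m => .inl ⟨m % es.length, Nat.mod_lt _ (List.length_pos_iff.2 hes)⟩
        | .halt => .inr none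
        | .dead => .inr (some false),
        Function.update c h (unroll es m (c h)).1, (unroll es m (c h)).2.1.move h⟩ := by
  obtain ⟨h₁, h₂, h₃⟩ := unroll_mod es m (c h)
  rw [TuringMachine.step, if_neg (by simp [machineOf]), h₁, h₂]
  simp only [machineOf]
  congr 1
  -- The two exits agree only up to residues, so they are compared case by case.
  generalize (unroll es m (c h)).2.2 = e at h₃ ⊢
  generalize (unroll es (m % es.length) (c h)).2.2 = e' at h₃ ⊢
  cases e <;> cases e' <;> simp_all [Exit.map]

/-- A terminating run never meets inaction, so it is irrelevant that the machine rejects there. -/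
theorem machineOf_iterate {es : List BlockSpec} (hes : es ≠ []) {k m : ℕ} {c c' : ℕ → Sym}
    {h h' : ℕ} (H : (unroll es).Halts k m c h c' h') :
    ∃ j ≤ k, (machineOf es hes).step^[j]
        ⟨.inl ⟨m % es.length, Nat.mod_lt _ (List.length_pos_iff.2 hes)⟩, c, h⟩ =
      ⟨.inr none, c', h'⟩ := by
  induction H with
  | halt e =>
    refine ⟨1, by omega, ?_⟩
    rw [Function.iterate_one, machineOf_step, e]
    rfl
  | step e H ih =>
    obtain ⟨j, hj, hit⟩ := ih
    refine ⟨j + 1, by omega, ?_⟩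
    rw [Function.iterate_succ_apply, machineOf_step, e]
    exact hit

theorem machineOf_verdict (es : List BlockSpec) (hes : es ≠ []) (c : ℕ → Sym) (h : ℕ) (v : Bool)
    (hv : c h = some v) :
    ((machineOf es hes).step ⟨.inr none, c, h⟩).state =
      if v then (machineOf es hes).accept else (machineOf es hes).reject := by
  rw [TuringMachine.step, if_neg (by simp [machineOf])]
  simp only [machineOf, hv]
  cases v <;> simp

/-! ### Closure properties of polynomial functions -/

theorem poly_add {S T : ℕ → ℕ} (hS : S ∈ poly) (hT : T ∈ poly) : (fun n => S n + T n) ∈ poly := by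
  obtain ⟨p, hp⟩ := hS
  obtain ⟨q, hq⟩ := hT
  exact ⟨p + q, fun n => by simp [hp, hq]⟩

theorem poly_mul {S T : ℕ → ℕ} (hS : S ∈ poly) (hT : T ∈ poly) : (fun n => S n * T n) ∈ poly := by
  obtain ⟨p, hp⟩ := hS
  obtain ⟨q, hq⟩ := hT
  exact ⟨p * q, fun n => by simp [hp, hq]⟩

theorem poly_const (k : ℕ) : (fun _ => k) ∈ poly := ⟨Polynomial.C (k : ℝ), fun n => by simp⟩

theorem poly_id : (fun n => n) ∈ poly := ⟨Polynomial.X, fun n => by simp⟩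

/-! ### Functions computed by programs in polynomial time belong to P -/

theorem mem_ClassP_of_computesInTime {F : List Bool → Bool} {t : Term ℕ} (ht : t ∈ TMPrograms)
    {T : ℕ → ℕ} (hT : T ∈ poly) (h : ComputesInTime t (ofDecision F) T) : F ∈ ClassP := by
  obtain ⟨es, hes, hseq⟩ := exists_specs_of_mem_TMPrograms ht
  have hs := implements_programSeq hes
  -- The extra step reads the output bit and enters the accepting or rejecting state.
  refine ⟨machineOf es hes, fun n => T n + 1, poly_add hT (poly_const 1), fun w => ?_⟩
  obtain ⟨k, hk, -, hcomp, -⟩ := h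
  obtain ⟨⟨s, happ⟩, hdepth⟩ := hcomp (fun _ => w) [F w] (by simp [ofDecision])
  set u := inputFamily k (fun _ : Fin 1 => w) with hu
  have hu1 : u 1 = .operative (TapeState.ofList (w.map some)) := by
    rw [hu, inputFamily_apply, if_pos ⟨le_rfl, hk⟩, if_pos rfl]
  have hupd : Function.update u 1 (.operative (TapeState.ofList (w.map some))) = u := by
    rw [← hu1, Function.update_eq_self]
  have hout := congrFun happ k
  rw [outputFamily_apply s hk] at hout
  have happrox : ∀ n, t.extract.approx n = (InSeq.inf (programSeq es)).extractApprox n (12 * 0) :=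
    fun n => by rw [← hseq]; rfl
  have hlen : ∑ i : Fin 1, ((fun _ : Fin 1 => w) i).length = w.length := by simp
  rw [hlen] at hdepth
  have hhalt : ∃ c' h', (unroll es).Halts (T w.length) 0
      (TapeState.ofList (w.map some)).cells (TapeState.ofList (w.map some)).head c' h' := by
    -- Inaction would give the empty family, which has no tape `k`; more than `T |w|` actions would
    -- violate the time bound.
    rcases hs.halts_or u (T w.length) 0 (TapeState.ofList (w.map some)) with H | H | ⟨n, hn⟩
    · exact H
    · rw [hupd] at H
      rw [Thread.apply_eq (v := Family.empty) (by simpa only [happrox] using H)] at hout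
      simp [Family.empty] at hout
    · rw [hupd, ← happrox] at hn
      have hle : (((t.extract.approx n).use u).depth : ℕ∞) ≤ (t.extract.use u).depth :=
        le_iSup (fun n => (((t.extract.use u).approx n).depth : ℕ∞)) n
      have := hle.trans hdepth
      exact absurd (by exact_mod_cast this) (not_le.2 hn)
  obtain ⟨c', h', H⟩ := hhalt
  obtain ⟨t', rfl, rfl, -, hfin⟩ := hs.of_halts u H _ rfl rfl
  rw [hupd] at hfin
  have happ' : t.extract.apply u = Function.update u 1 (.operative t') := by
    refine Thread.apply_eq ?_
    filter_upwards [Filter.eventually_ge_atTop (4 * T w.length + 1)] with n hn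
    rw [happrox]
    exact hfin n hn
  rw [happ'] at hout
  have ht' : t' = TapeState.ofList ([F w].map some) := by
    -- A tape other than tape `1` is never touched and stays blank, so it cannot hold the output
    -- bit.
    rcases eq_or_ne k 1 with rfl | hk1
    · simpa using hout
    · rw [Function.update_of_ne hk1, hu, inputFamily_apply, if_pos ⟨hk, le_rfl⟩, if_neg hk1] at hout
      have := congrArg (fun t => t.cells 0) (Entry.operative.inj hout)
      simp [TapeState.ofList] at this
  obtain ⟨j, hj, hit⟩ := machineOf_iterate hes H
  refine ⟨j + 1, Nat.succ_le_succ hj, ?_⟩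
  rw [Function.iterate_succ_apply']
  have hstart : (machineOf es hes).startCfg w =
      ⟨.inl ⟨0 % es.length, Nat.mod_lt _ (List.length_pos_iff.2 hes)⟩,
        (TapeState.ofList (w.map some)).cells, (TapeState.ofList (w.map some)).head⟩ := by
    simp [TuringMachine.startCfg, machineOf, TapeState.ofList]
  rw [hstart, hit]
  exact machineOf_verdict _ _ _ _ _ (by simp [ht', TapeState.ofList])

/-! ## From automata to programs -/

section

open Classical in
/-- The blocks that implement an automaton whose states are enumerated by the list `l`. -/
noncomputable def Auto.blocks {σ : Type} (A : Auto σ) (l : List σ) (q₀ : σ) : List BlockSpec :=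
  (List.range l.length).map fun i b =>
    ((A (l.getD i q₀) b).1, (A (l.getD i q₀) b).2.1,
      (A (l.getD i q₀) b).2.2.map fun q => (l.idxOf q + (l.length - 1 - i)) % l.length)

variable {σ : Type} {A : Auto σ} {l : List σ} {q₀ : σ}

theorem Auto.length_blocks : (A.blocks l q₀).length = l.length := by simp [Auto.blocks]

theorem Auto.bounded_blocks : ∀ E ∈ A.blocks l q₀, E.Bounded (A.blocks l q₀).length := by
  intro E hE b j hj
  rw [Auto.length_blocks]
  simp only [Auto.blocks, List.mem_map, List.mem_range] at hE
  obtain ⟨i, hi, rfl⟩ := hE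
  dsimp only at hj
  cases h : (A (l.getD i q₀) b).2.2 with
  | goto q =>
    rw [h] at hj
    cases hj
    exact Nat.mod_lt _ (by omega)
  | halt => rw [h] at hj; cases hj
  | dead => rw [h] at hj; cases hj

/-- Jumps only go forward, so a block is reached from block `m` by going round the cycle: the
displacement, counted from block `m + 1`, is the difference of the indices modulo `n`. -/
theorem relative_mod {n m x : ℕ} (hx : x < n) :
    (m + 1 + (x + (n - 1 - m % n)) % n) % n = x := by
  have h₁ := Nat.mod_add_div m n
  have h₂ : m % n < n := Nat.mod_lt _ (by omega)
  rw [Nat.add_mod_mod, show m + 1 + (x + (n - 1 - m % n)) = x + n * (m / n + 1) by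
    rw [mul_add]; omega, Nat.add_mul_mod_self_left, Nat.mod_eq_of_lt hx]

-- The invariant is that the position in the unrolled sequence is congruent to the index of the
-- current state. Closure of `l` under transitions ensures that each next state has an index.
open Classical in
theorem Auto.halts_unroll_blocks (hl : ∀ q ∈ l, ∀ b q', (A q b).2.2 = .goto q' → q' ∈ l)
    {k : ℕ} {q : σ} {c c' : ℕ → Sym} {h h' : ℕ} (H : A.Halts k q c h c' h') (hq : q ∈ l) (m : ℕ)
    (hm : m % l.length = l.idxOf q) : (unroll (A.blocks l q₀)).Halts k m c h c' h' := by
  have key : ∀ (q : σ) (hq : q ∈ l) (m : ℕ) (hm : m % l.length = l.idxOf q) (b : Sym),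
      unroll (A.blocks l q₀) m b = ((A q b).1, (A q b).2.1, (A q b).2.2.map fun q' =>
        m + 1 + (l.idxOf q' + (l.length - 1 - m % l.length)) % l.length) := by
    intro q hq m hm b
    have hlt : l.idxOf q < l.length := List.idxOf_lt_length_of_mem hq
    have hget : l.getD (l.idxOf q) q₀ = q := by
      rw [List.getD_eq_getElem _ _ hlt, List.getElem_idxOf]
    rw [unroll, Auto.length_blocks, hm]
    simp only [Auto.blocks]
    rw [List.getD_eq_getElem _ _ (by simpa using hlt)]
    simp only [List.getElem_map, List.getElem_range, hget]
    cases (A q b).2.2 <;> rfl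
  induction H generalizing m with
  | halt e =>
    refine .halt ?_
    rw [key _ hq m hm, e]
    rfl
  | @step k q q' c c' h h' y d e H ih =>
    have hq' : q' ∈ l := hl q hq (c h) q' (by rw [e])
    refine .step (y := y) (d := d) ?_ (ih hq' _
      (relative_mod (m := m) (List.idxOf_lt_length_of_mem hq')))
    rw [key _ hq m hm, e]
    rfl

end

/-- An automaton with finitely many states that computes `F` in time `T` gives rise to a program
that computes `F` in time `4 T`. -/
theorem exists_program {σ : Type} (A : Auto σ) {S : Set σ} (hS : S.Finite)
    (hcl : ∀ q ∈ S, ∀ b q', (A q b).2.2 = .goto q' → q' ∈ S) {q₀ : σ} (hq₀ : q₀ ∈ S)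
    {F : List Bool → Bool} {T : ℕ → ℕ}
    (H : ∀ w : List Bool, A.Halts (T w.length) q₀ (TapeState.ofList (w.map some)).cells 0
      (TapeState.ofList [some (F w)]).cells 0) :
    ∃ t ∈ TMPrograms, ComputesInTime t (ofDecision F) (fun n => 4 * T n) := by
  classical
  -- Execution starts with block `0`, so `q₀` comes first. Its second occurrence is harmless, as
  -- `idxOf` finds the first.
  set l : List σ := q₀ :: hS.toFinset.toList with hl
  have hmem : ∀ q, q ∈ l ↔ q ∈ S := by
    intro q
    simp only [hl, List.mem_cons, Finset.mem_toList, Set.Finite.mem_toFinset, or_iff_right_iff_imp]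
    rintro rfl
    exact hq₀
  have hne : A.blocks l q₀ ≠ [] := by
    rw [← List.length_pos_iff, Auto.length_blocks]
    simp [hl]
  obtain ⟨t, ht, hseq, hfoci⟩ := exists_mem_TMPrograms hne Auto.bounded_blocks
  refine ⟨t, ht, 1, le_rfl, hfoci, ?_, fun w hw => absurd trivial hw⟩
  intro w y hy
  obtain rfl : y = [F (w 0)] := by simpa [ofDecision] using hy
  have hu : inputFamily 1 w = Function.update Family.empty 1
      (.operative (TapeState.ofList ((w 0).map some))) := by
    funext f
    rw [inputFamily_apply]
    rcases eq_or_ne f 1 with rfl | hf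
    · simp
    · rw [if_neg (by omega), Function.update_of_ne hf]
      rfl
  have H' := Auto.halts_unroll_blocks (q₀ := q₀)
    (fun q hq b q' h => (hmem q').2 (hcl q ((hmem q).1 hq) b q' h)) (H (w 0)) ((hmem _).2 hq₀) 0
    (by simp [hl])
  obtain ⟨t', hc, hh, hd, ha⟩ := (implements_programSeq hne).of_halts Family.empty H'
    (TapeState.ofList ((w 0).map some)) rfl rfl
  obtain rfl : t' = TapeState.ofList [some (F (w 0))] := by
    ext1
    · exact hc
    · exact hh
  have happrox : ∀ n, t.extract.approx n =
      (InSeq.inf (programSeq (A.blocks l q₀))).extractApprox n (12 * 0) :=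
    fun n => by rw [← hseq]; rfl
  rw [hu]
  -- With `k = 1` there are no auxiliary tapes, so this witness is arbitrary.
  refine ⟨⟨fun _ => TapeState.ofList [], ?_⟩, ?_⟩
  · have : t.extract.apply (Function.update Family.empty 1
        (.operative (TapeState.ofList ((w 0).map some)))) =
        Function.update Family.empty 1 (.operative (TapeState.ofList [some (F (w 0))])) := by
      refine Thread.apply_eq ?_
      filter_upwards [Filter.eventually_ge_atTop (4 * T (w 0).length + 1)] with n hn
      rw [happrox]
      exact ha n hn
    rw [this]
    rfl
  · refine iSup_le fun n => ?_
    have := hd n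
    rw [← happrox] at this
    rw [Fin.sum_univ_one]
    exact_mod_cast this

/-! ## Tapes as pairs of lists -/

section

variable {Γ : Type} (blank : Γ)

/-- The contents of the tape with `L` (in reverse order) to the left of the head and `R` from the
head on; the head is on cell `L.length`. -/
def tapeOf (L R : List Γ) : ℕ → Γ := fun i => (L.reverse ++ R).getD i blank

/-- Writing the head symbol `y` of the right part and moving the head. -/
def zmove : Dir → List Γ → Γ → List Γ → List Γ × List Γ
  | .left, [], y, R => ([], y :: R)
  | .left, a :: L, y, R => (L, a :: y :: R)
  | .stay, L, y, R => (L, y :: R)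
  | .right, L, y, R => (y :: L, R)

variable {blank}

theorem tapeOf_cons_left (a : Γ) (L R : List Γ) :
    tapeOf blank (a :: L) R = tapeOf blank L (a :: R) := by
  funext i
  simp [tapeOf]

theorem tapeOf_zmove (d : Dir) (L : List Γ) (y : Γ) (R : List Γ) :
    tapeOf blank (zmove d L y R).1 (zmove d L y R).2 = tapeOf blank L (y :: R) := by
  cases d with
  | left => cases L <;> simp [zmove, tapeOf_cons_left]
  | stay => rfl
  | right => simp [zmove, tapeOf_cons_left]

theorem length_zmove (d : Dir) (L : List Γ) (y : Γ) (R : List Γ) :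
    (zmove d L y R).1.length = d.move L.length := by
  cases d with
  | left => cases L <;> simp [zmove, Dir.move]
  | stay => rfl
  | right => simp [zmove, Dir.move]

theorem tapeOf_head (L R : List Γ) : tapeOf blank L R L.length = R.headD blank := by
  cases R <;> simp [tapeOf]

/-- Trailing blanks are invisible in the contents, so the right part may be padded or trimmed at
will. -/
theorem tapeOf_append_replicate (L R : List Γ) (j : ℕ) :
    tapeOf blank L (R ++ List.replicate j blank) = tapeOf blank L R := by
  funext i
  simp only [tapeOf, ← List.append_assoc]
  rcases lt_or_ge i (L.reverse ++ R).length with hi | hi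
  · rw [List.getD_append _ _ _ _ hi]
  · rw [List.getD_append_right _ _ _ _ hi, List.getD_eq_default _ _ hi]
    simp [List.getD_eq_getElem?_getD, List.getElem?_replicate]
    split <;> rfl

theorem tapeOf_headD_tail (L R : List Γ) :
    tapeOf blank L (R.headD blank :: R.tail) = tapeOf blank L R := by
  cases R with
  | nil => exact tapeOf_append_replicate L [] 1
  | cons x R => rfl

theorem update_tapeOf (L R : List Γ) (y : Γ) :
    Function.update (tapeOf blank L R) L.length y = tapeOf blank L (y :: R.tail) := by
  rw [← tapeOf_headD_tail L R]
  funext i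
  rw [Function.update_apply]
  simp only [tapeOf, List.getD_eq_getElem?_getD, List.getElem?_append, List.length_reverse]
  split
  · simp_all
  · split
    · rfl
    · obtain ⟨j, hj⟩ := Nat.exists_eq_add_of_le' (show 1 ≤ i - L.length by omega)
      rw [hj]
      simp

end

theorem TuringMachine.step_tapeOf (M : TuringMachine) {q : M.Q} (h₁ : q ≠ M.accept)
    (h₂ : q ≠ M.reject) (L R : List M.Γ) :
    M.step ⟨q, tapeOf M.blank L R, L.length⟩ =
      ⟨(M.δ q (R.headD M.blank)).1,
        tapeOf M.blank
          (zmove (M.δ q (R.headD M.blank)).2.2 L (M.δ q (R.headD M.blank)).2.1 R.tail).1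
          (zmove (M.δ q (R.headD M.blank)).2.2 L (M.δ q (R.headD M.blank)).2.1 R.tail).2,
        (zmove (M.δ q (R.headD M.blank)).2.2 L (M.δ q (R.headD M.blank)).2.1 R.tail).1.length⟩ := by
  rw [TuringMachine.step, if_neg (by simp [h₁, h₂])]
  simp only [tapeOf_head, update_tapeOf, tapeOf_zmove, length_zmove]

/-! ## Runs of automata -/

namespace Auto

variable {σ : Type} {A : Auto σ}

theorem Halts.mono {k k' : ℕ} {q : σ} {c c' : ℕ → Sym} {h h' : ℕ} (H : A.Halts k q c h c' h')
    (hk : k ≤ k') : A.Halts k' q c h c' h' := by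
  induction H generalizing k' with
  | halt e =>
    obtain ⟨k', rfl⟩ := Nat.exists_eq_add_of_le' (show 1 ≤ k' by omega)
    exact .halt e
  | step e H ih =>
    obtain ⟨k', rfl⟩ := Nat.exists_eq_add_of_le' (show 1 ≤ k' by omega)
    exact .step e (ih (by omega))

/-- `A` gets within `k` steps from state `q` and tape `(L, R)` to state `q'` and tape `(L', R')`,
in the sense that termination from the latter implies termination from the former. -/
def Runs (A : Auto σ) (k : ℕ) (q : σ) (L R : List Sym) (q' : σ) (L' R' : List Sym) : Prop :=
  ∀ j c' h', A.Halts j q' (tapeOf none L' R') L'.length c' h' →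
    A.Halts (k + j) q (tapeOf none L R) L.length c' h'

variable {k k' : ℕ} {q q' q'' : σ} {L R L' R' L'' R'' : List Sym}

theorem Runs.refl : A.Runs k q L R q L R := fun _ _ _ H => H.mono (by omega)

theorem Runs.trans (h : A.Runs k q L R q' L' R') (h' : A.Runs k' q' L' R' q'' L'' R'') :
    A.Runs (k + k') q L R q'' L'' R'' := fun _ _ _ H => by
  rw [add_assoc]
  exact h _ _ _ (h' _ _ _ H)

theorem Runs.mono (h : A.Runs k q L R q' L' R') (hk : k ≤ k') : A.Runs k' q L R q' L' R' :=
  fun _ _ _ H => (h _ _ _ H).mono (by omega)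

/-- Runs depend only on the contents that the lists denote; this is how blank padding is introduced
and removed. -/
theorem Runs.congr_left (h : A.Runs k q L R q' L' R') (hR : tapeOf none L R'' = tapeOf none L R) :
    A.Runs k q L R'' q' L' R' := fun j c' h' H => hR ▸ h j c' h' H

theorem Runs.congr_right (h : A.Runs k q L R q' L' R')
    (hR : tapeOf none L' R'' = tapeOf none L' R') : A.Runs k q L R q' L' R'' :=
  fun j c' h' H => h j c' h' (hR ▸ H)

theorem Runs.single {y : Sym} {d : Dir} (e : A q (R.headD none) = (y, d, .goto q')) :
    A.Runs 1 q L R q' (zmove d L y R.tail).1 (zmove d L y R.tail).2 := by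
  intro j c' h' H
  rw [add_comm]
  rw [tapeOf_zmove, length_zmove, ← update_tapeOf] at H
  exact .step (by rw [tapeOf_head]; exact e) H

theorem Runs.head {y : Sym} {d : Dir} (e : A q (R.headD none) = (y, d, .goto q'))
    (h : A.Runs k q' (zmove d L y R.tail).1 (zmove d L y R.tail).2 q'' L'' R'') :
    A.Runs (k + 1) q L R q'' L'' R'' := by
  rw [add_comm]
  exact (Runs.single e).trans h

theorem halts_single {y : Sym} {d : Dir} (e : A q (R.headD none) = (y, d, .halt)) :
    A.Halts 1 q (tapeOf none L R) L.length (tapeOf none L (y :: R.tail)) (d.move L.length) := by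
  rw [← update_tapeOf]
  exact .halt (by rw [tapeOf_head]; exact e)

/-- Moving to the right over bits. -/
theorem Runs.scan_right (hA : ∀ x : Bool, A q (some x) = (some x, .right, .goto q)) (l : List Bool)
    (L R : List Sym) :
    A.Runs l.length q L (l.map some ++ R) q ((l.map some).reverse ++ L) R := by
  induction l generalizing L with
  | nil => exact .refl
  | cons x l ih =>
    refine .head (hA x) ?_
    simpa [zmove] using ih (some x :: L)

/-- Moving to the left over bits up to the next blank, starting with a left move. -/
theorem Runs.scan_left (f : Bool → Sym)
    (hA : ∀ x : Bool, A q (some x) = (f x, .left, .goto q)) (l : List Bool)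
    (L : List Sym) (y : Sym) (R : List Sym) :
    A.Runs l.length q (zmove .left (l.map some ++ none :: L) y R).1
      (zmove .left (l.map some ++ none :: L) y R).2 q L (none :: ((l.map f).reverse ++ y :: R)) := by
  induction l generalizing y R with
  | nil => exact .refl
  | cons x l ih =>
    refine .head (hA x) ?_
    simpa [zmove] using ih (f x) (y :: R)

end Auto

/-! ## Simulation of Turing machines with an arbitrary tape alphabet -/

/-- A coding of the symbols of an alphabet by non-empty bit strings of the same length. -/
structure Coding (Γ : Type) : Type where
  size : ℕ
  enc : Γ → List Bool
  size_pos : 0 < size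
  length_enc : ∀ g, (enc g).length = size
  enc_injective : Function.Injective enc

/-- The code of a symbol is its indicator vector over the alphabet; the entry at `g` separates `g`
from any other symbol. -/
theorem exists_coding (Γ : Type) [Finite Γ] [Nonempty Γ] : Nonempty (Coding Γ) := by
  classical
  have := Fintype.ofFinite Γ
  refine ⟨⟨Fintype.card Γ, fun g => Finset.univ.toList.map fun x => decide (x = g),
    Fintype.card_pos, fun g => by simp, fun g g' h => ?_⟩⟩
  simpa using List.map_inj_left.1 h g (by simp)

namespace Coding

variable {Γ : Type} (C : Coding Γ)

/-- The cells that hold the code of a symbol. -/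
def cells (g : Γ) : List Sym := (C.enc g).map some

open Classical in
/-- The symbol with the given code, where the code is read from right to left. Cells that do not
hold a code stand for the blank. -/
noncomputable def dec (blank : Γ) (l : List Sym) : Γ :=
  if h : ∃ g, (C.cells g).reverse = l then h.choose else blank

theorem length_cells (g : Γ) : (C.cells g).length = C.size := by simp [cells, C.length_enc]

theorem dec_cells (blank g : Γ) : C.dec blank (C.cells g).reverse = g := by
  have hex : ∃ g', (C.cells g').reverse = (C.cells g).reverse := ⟨g, rfl⟩
  rw [dec, dif_pos hex]
  exact C.enc_injective (List.map_injective_iff.2 (Option.some_injective _)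
    (List.reverse_injective hex.choose_spec))

/-- Codes are non-empty and consist of bits, so a run of `□` is no code. Unvisited cells thus
represent blanks of the machine without being initialized. -/
theorem dec_replicate (blank : Γ) : C.dec blank (List.replicate C.size none) = blank := by
  rw [dec, dif_neg]
  rintro ⟨g, hg⟩
  have h : (none : Sym) ∈ (C.cells g).reverse := by
    rw [hg]
    exact List.mem_replicate.2 ⟨C.size_pos.ne', rfl⟩
  simp [cells] at h

theorem cells_ne_nil (g : Γ) : C.cells g ≠ [] := by
  rw [← List.length_pos_iff, length_cells]
  exact C.size_pos

end Coding

/-- The states of the simulating automaton. The input is converted bit by bit: a bit is erased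
(`load`), carried past the rest of the input and past the codes that are there already
(`carry`, `carryOn`), and its code is appended to the latter (`append`); then the head returns
(`back`, `backOn`). A simulated step reads a code (`readCode`), replaces it from right to left
(`writeCode`), and moves to another code (`moveRight`, `moveLeft`). In the end the head moves to the end
of the codes (`seekEnd`), these are erased (`erase`), and the first cell is searched: it is reached
if a bit that has been written before a left move (`probe`) is still there after the move
(`check`); otherwise that bit is removed (`restore`). -/
inductive SimState (Q : Type) : Type
  | load
  | carry (b : Bool)
  | carryOn (b : Bool)
  | append (l : List Bool)
  | back
  | backOn
  | readCode (q : Q) (l : List Sym)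
  | writeCode (q : Q) (d : Dir) (l : List Bool)
  | moveRight (q : Q) (j : ℕ)
  | moveLeft (q : Q) (j : ℕ)
  | seekEnd (v : Bool)
  | erase (v : Bool)
  | probe (v : Bool)
  | check (v : Bool)
  | restore (v : Bool)

section

open SimState

variable (M : TuringMachine) (C : Coding M.Γ)

open Classical in
/-- The state in which the simulation of a state starts. -/
noncomputable def enter (q : M.Q) : SimState M.Q :=
  if q = M.accept then seekEnd true else if q = M.reject then seekEnd false else readCode q []

/-- The automaton that simulates `M`. -/
noncomputable def simAuto : Auto (SimState M.Q)
  | load, some b => (none, .right, .goto (carry b))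
  | load, none => (none, .right, .goto (enter M M.start))
  | carry b, some x => (some x, .right, .goto (carry b))
  | carry b, none => (none, .right, .goto (carryOn b))
  | carryOn b, some x => (some x, .right, .goto (carryOn b))
  | carryOn b, none => (none, .stay, .goto (append (C.enc (M.bit b))))
  | append (x :: l), _ => (some x, .right, .goto (append l))
  | append [], s => (s, .left, .goto back)
  | back, some x => (some x, .left, .goto back)
  | back, none => (none, .left, .goto backOn)
  | backOn, some x => (some x, .left, .goto backOn)
  | backOn, none => (none, .right, .goto load)
  | readCode q l, s =>
    if l.length + 1 = C.size then
      (s, .stay, .goto (writeCode (M.δ q (C.dec M.blank (s :: l))).1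
        (M.δ q (C.dec M.blank (s :: l))).2.2
        (C.enc (M.δ q (C.dec M.blank (s :: l))).2.1).reverse))
    else (s, .right, .goto (readCode q (s :: l)))
  | writeCode q d (x :: l), _ => (some x, .left, .goto (writeCode q d l))
  | writeCode q .stay [], s => (s, .right, .goto (enter M q))
  | writeCode q .right [], s => (s, .right, .goto (moveRight q C.size))
  | writeCode q .left [], none => (none, .right, .goto (enter M q))
  | writeCode q .left [], some x => (some x, .stay, .goto (moveLeft q (C.size - 1)))
  | moveRight q (j + 1), s => (s, .right, .goto (moveRight q j))
  | moveRight q 0, s => (s, .stay, .goto (enter M q))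
  | moveLeft q (j + 1), s => (s, .left, .goto (moveLeft q j))
  | moveLeft q 0, s => (s, .stay, .goto (enter M q))
  | seekEnd v, some x => (some x, .right, .goto (seekEnd v))
  | seekEnd v, none => (none, .left, .goto (erase v))
  | erase v, some _ => (none, .left, .goto (erase v))
  | erase v, none => (none, .stay, .goto (probe v))
  | probe v, _ => (some true, .left, .goto (check v))
  | check v, some _ => (some v, .stay, .halt)
  | check v, none => (none, .right, .goto (restore v))
  | restore v, _ => (none, .left, .goto (probe v))

/-- The states that can be reached. -/
def SimState.Bounded (n : ℕ) {Q : Type} : SimState Q → Prop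
  | append l => l.length ≤ n
  | readCode _ l => l.length < n
  | writeCode _ _ l => l.length ≤ n
  | moveRight _ j => j ≤ n
  | moveLeft _ j => j ≤ n
  | _ => True

instance : Finite Dir :=
  Finite.of_surjective (fun i : Fin 3 => if i = 0 then Dir.left else if i = 1 then .stay else .right)
    fun
    | .left => ⟨0, rfl⟩
    | .stay => ⟨1, rfl⟩
    | .right => ⟨2, rfl⟩

/-- The type of states is infinite, but bounded lists over finite alphabets and bounded counters
leave finitely many. -/
theorem SimState.finite_bounded (n : ℕ) (Q : Type) [Finite Q] :
    {s : SimState Q | s.Bounded n}.Finite := by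
  have hl : ∀ (α : Type) [Finite α], {l : List α | l.length ≤ n}.Finite :=
    fun α _ => List.finite_length_le α n
  have hj : {j : ℕ | j ≤ n}.Finite := Set.finite_le_nat n
  have huQ : (Set.univ : Set Q).Finite := Set.finite_univ
  have huB : (Set.univ : Set Bool).Finite := Set.finite_univ
  refine Set.Finite.subset
    ((((((((((((Set.toFinite {load, back, backOn}).union (huB.image carry)).union
      (huB.image carryOn)).union ((hl Bool).image append)).union
      (huQ.image2 readCode (hl Sym))).union
      ((Set.finite_univ (α := Q × Dir)).image2 (fun p l => writeCode p.1 p.2 l) (hl Bool))).union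
      (huQ.image2 moveRight hj)).union (huQ.image2 moveLeft hj)).union
      (huB.image seekEnd)).union (huB.image erase)).union (huB.image probe)).union
      ((huB.image check).union (huB.image restore))) ?_
  intro s hs
  cases s <;> simp_all [SimState.Bounded, le_of_lt]

theorem bounded_enter (q : M.Q) : (enter M q).Bounded C.size := by
  rw [enter]
  split_ifs
  · trivial
  · trivial
  · exact C.size_pos

/-- The strict bound for `readCode` survives because that state is left as soon as a full code has
been read. -/
theorem bounded_simAuto (s : SimState M.Q) (hs : s.Bounded C.size) (b : Sym) (s' : SimState M.Q)
    (h : (simAuto M C s b).2.2 = .goto s') : s'.Bounded C.size := by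
  have he := bounded_enter M C
  have hp := C.size_pos
  unfold simAuto at h
  split at h <;> first
    | (cases h; done)
    | (cases h; exact he _)
    | (cases h; simp_all [SimState.Bounded, C.length_enc]; done)
    | (cases h; simp_all [SimState.Bounded]; omega)
    | (split_ifs at h <;> cases h <;> simp_all [SimState.Bounded, C.length_enc]; omega)

end

section

open SimState Auto

variable {M : TuringMachine} {C : Coding M.Γ}

/-! ### Conversion of the input -/

theorem runs_append (l : List Bool) (L : List Sym) :
    (simAuto M C).Runs l.length (append l) L [] (append []) ((l.map some).reverse ++ L) [] := by
  induction l generalizing L with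
  | nil => exact .refl
  | cons x l ih =>
    refine .head (y := some x) (d := .right) (q' := append l) rfl ?_
    simpa [zmove] using ih (some x :: L)

/-- One round trip: right over the rest `w` and the codes `E`, append the new code, and back over
both. The blank left by the erased bit stops the return. -/
theorem runs_load_bit (b : Bool) (w E : List Bool) (L : List Sym) :
    (simAuto M C).Runs (2 * w.length + 2 * E.length + 2 * C.size + 6) load L
      (some b :: (w.map some ++ none :: E.map some)) load (none :: L)
      (w.map some ++ none :: (E ++ C.enc (M.bit b)).map some) := by
  have h₁ : (simAuto M C).Runs (w.length + 1) load L
      (some b :: (w.map some ++ none :: E.map some)) (carry b)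
      ((w.map some).reverse ++ none :: L) (none :: E.map some) :=
    .head (y := none) (d := .right) (q' := carry b) rfl (.scan_right (fun _ => rfl) _ _ _)
  have h₂ : (simAuto M C).Runs (E.length + 1) (carry b)
      ((w.map some).reverse ++ none :: L) (none :: E.map some) (carryOn b)
      ((E.map some).reverse ++ none :: ((w.map some).reverse ++ none :: L)) [] :=
    .head (y := none) (d := .right) (q' := carryOn b) rfl (by
      simpa [zmove] using Runs.scan_right (A := simAuto M C) (q := carryOn b) (fun _ => rfl) E
        (none :: ((w.map some).reverse ++ none :: L)) [])
  have h₃ : ∀ L', (simAuto M C).Runs 1 (carryOn b) L' []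
      (append (C.enc (M.bit b))) L' [] := fun L' =>
    (Runs.single (y := none) (d := .stay) (q' := append (C.enc (M.bit b))) rfl).congr_right
      (tapeOf_headD_tail L' []).symm
  have h₄ := runs_append (M := M) (C := C) (C.enc (M.bit b))
    ((E.map some).reverse ++ none :: ((w.map some).reverse ++ none :: L))
  rw [C.length_enc, ← List.append_assoc, ← List.reverse_append, ← List.map_append] at h₄
  set E' := E ++ C.enc (M.bit b) with hE'
  have hlen : E'.length = E.length + C.size := by simp [hE', C.length_enc]
  have h₅ : (simAuto M C).Runs (E'.length + 1) (append [])
      ((E'.map some).reverse ++ none :: ((w.map some).reverse ++ none :: L)) [] back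
      ((w.map some).reverse ++ none :: L) (none :: E'.map some) :=
    .head (y := none) (d := .left) (q' := back) rfl (.congr_right
      (R' := none :: (E'.map some ++ [none]))
      (by simpa using Runs.scan_left (A := simAuto M C) (q := back) some (fun _ => rfl) E'.reverse
            ((w.map some).reverse ++ none :: L) none [])
      (tapeOf_append_replicate _ (none :: E'.map some) 1).symm)
  have h₆ : (simAuto M C).Runs (w.length + 1) back
      ((w.map some).reverse ++ none :: L) (none :: E'.map some) backOn L
      (none :: (w.map some ++ none :: E'.map some)) :=
    .head (y := none) (d := .left) (q' := backOn) rfl (by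
      simpa using Runs.scan_left (A := simAuto M C) (q := backOn) some (fun _ => rfl) w.reverse
        L none (E'.map some))
  have h₇ : (simAuto M C).Runs 1 backOn L (none :: (w.map some ++ none :: E'.map some)) load
      (none :: L) (w.map some ++ none :: E'.map some) :=
    .single (y := none) (d := .right) rfl
  exact ((((((h₁.trans h₂).trans (h₃ _)).trans h₄).trans h₅).trans h₆).trans h₇).mono (by omega)

/-- The cells that hold the codes of a list of symbols. -/
def codes (C : Coding M.Γ) (ys : List M.Γ) : List Sym := ys.flatMap C.cells

theorem length_codes (ys : List M.Γ) : (codes C ys).length = C.size * ys.length := by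
  induction ys with
  | nil => rfl
  | cons y ys ih =>
    rw [codes, List.flatMap_cons, List.length_append, C.length_cells, ← codes, ih,
      List.length_cons]
    ring

theorem codes_eq_map (ys : List M.Γ) : codes C ys = (ys.flatMap C.enc).map some := by
  rw [codes, List.map_flatMap]
  rfl

/-- One `P` bounds every round, because `|E| + C.size * |w|` is invariant: a round removes a bit
from `w` and adds a code to `E`. Each round leaves one blank, and the separator is the last of the
`|w| + 1`. -/
theorem runs_load {P i : ℕ} {w E : List Bool}
    (hP : 2 * w.length + 2 * (E.length + C.size * w.length) + 6 ≤ P) :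
    (simAuto M C).Runs (w.length * P + 1) load (List.replicate i none)
      (w.map some ++ none :: E.map some) (enter M M.start)
      (List.replicate (i + w.length + 1) none)
      (E.map some ++ codes C (w.map M.bit)) := by
  induction w generalizing i E with
  | nil =>
    refine .mono (k := 1) ?_ (by simp)
    simpa [zmove, codes, List.replicate_succ] using
      Runs.single (A := simAuto M C) (q := load) (L := List.replicate i none)
        (R := none :: E.map some) (y := none) (d := .right) rfl
  | cons b w ih =>
    have hlen : (E ++ C.enc (M.bit b)).length = E.length + C.size := by simp [C.length_enc]
    have hP' : 2 * w.length + 2 * (E.length + C.size + C.size * w.length) + 8 ≤ P := by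
      rw [List.length_cons] at hP
      linarith
    have h := ih (i := i + 1) (E := E ++ C.enc (M.bit b)) (by rw [hlen]; omega)
    have hb := runs_load_bit (C := C) b w E (List.replicate i none)
    rw [← List.replicate_succ] at hb
    have hR : (E ++ C.enc (M.bit b)).map some ++ codes C (w.map M.bit) =
        E.map some ++ codes C ((b :: w).map M.bit) := by
      rw [List.map_append, List.append_assoc]
      rfl
    rw [hR, show i + 1 + w.length + 1 = i + (b :: w).length + 1 by
      rw [List.length_cons]; omega] at h
    refine (hb.trans h).mono ?_
    rw [List.length_cons, Nat.add_one_mul w.length P]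
    omega

/-! ### Simulation of a step -/

/-- The cells to the left of the head, in reverse order, when the symbols `xs` are to the left of
the simulated head. -/
def leftCells (C : Coding M.Γ) (n : ℕ) (xs : List M.Γ) : List Sym :=
  xs.flatMap (fun g => (C.cells g).reverse) ++ List.replicate (n + 1) none

/-- `acc` holds the cells read so far, latest first, which is the order that `dec` expects. The head
ends on the last cell of the code, ready for overwriting it from right to left. -/
theorem runs_readCode (q : M.Q) (l₀ acc : List Sym) (x : Sym) (L R : List Sym)
    (hl : acc.length + l₀.length + 1 = C.size) {g : M.Γ}
    (hg : C.dec M.blank (x :: (l₀.reverse ++ acc)) = g) :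
    (simAuto M C).Runs (l₀.length + 1) (readCode q acc) L (l₀ ++ x :: R)
      (writeCode (M.δ q g).1 (M.δ q g).2.2 (C.enc (M.δ q g).2.1).reverse)
      (l₀.reverse ++ L) (x :: R) := by
  induction l₀ generalizing acc L with
  | nil =>
    refine .single (d := .stay) ?_
    subst hg
    simp at hl
    simp [simAuto, hl]
  | cons z l₀ ih =>
    simp only [List.length_cons] at hl
    refine .head (y := z) (d := .right) (q' := readCode q (z :: acc)) ?_ ?_
    · rw [simAuto, if_neg (by omega)]
      rfl
    · simpa [zmove] using ih (z :: acc) (z :: L) (by simp; omega) (by simpa using hg)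

/-- The state holds the reversed code, so consuming it leftwards leaves the code in reading order.
Of the old cells only the number matters. -/
theorem runs_writeCode (q : M.Q) (d : Dir) (p : List Bool) (l : List Sym) (y : Bool) (x a : Sym)
    (L R : List Sym) (hl : l.length = p.length) :
    (simAuto M C).Runs (p.length + 1) (writeCode q d (y :: p)) (l ++ a :: L) (x :: R)
      (writeCode q d []) L (a :: ((y :: p).reverse.map some ++ R)) := by
  induction p generalizing l y x R with
  | nil =>
    obtain rfl := List.length_eq_zero_iff.1 hl
    exact .single (y := some y) (d := .left) rfl
  | cons z p ih =>
    cases l with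
    | nil => simp at hl
    | cons b l =>
      refine .head (y := some y) (d := .left) (q' := writeCode q d (z :: p)) rfl ?_
      simpa [zmove] using ih l z b (some y :: R) (by simpa using hl)

theorem runs_moveRight (q : M.Q) (l L R : List Sym) :
    (simAuto M C).Runs (l.length + 1) (moveRight q l.length) L (l ++ R) (enter M q)
      (l.reverse ++ L) R := by
  induction l generalizing L with
  | nil =>
    exact (Runs.single (y := R.headD none) (d := .stay) rfl).congr_right
      (tapeOf_headD_tail L R).symm
  | cons x l ih =>
    refine .head (y := x) (d := .right) (q' := moveRight q l.length) rfl ?_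
    simpa [zmove] using ih (x :: L)

theorem runs_moveLeft (q : M.Q) (l L R : List Sym) (z : Sym) :
    (simAuto M C).Runs (l.length + 1) (moveLeft q l.length) (l ++ L) (z :: R) (enter M q)
      L (l.reverse ++ z :: R) := by
  induction l generalizing z R with
  | nil => exact .single (y := z) (d := .stay) rfl
  | cons x l ih =>
    refine .head (y := z) (d := .left) (q' := moveLeft q l.length) rfl ?_
    simpa [zmove] using ih (z :: R) x

/-- After writing, the head is on the cell `a` just before the code. For a left move, `a` is blank
exactly if the simulated head is on its first cell; otherwise `a` is the last bit of the preceding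
code, whose start is `C.size - 1` cells further left. -/
theorem runs_move (q : M.Q) (d : Dir) (n : ℕ) (xs ys : List M.Γ) (g : M.Γ) {a : Sym}
    {L : List Sym} (hL : leftCells C n xs = a :: L) :
    (simAuto M C).Runs (C.size + 2) (writeCode q d []) L (a :: codes C (g :: ys)) (enter M q)
      (leftCells C n (zmove d xs g ys).1) (codes C (zmove d xs g ys).2) := by
  cases d with
  | stay =>
    simp only [zmove, hL]
    exact (Runs.single (y := a) (d := .right) rfl).mono (by omega)
  | right =>
    refine .head (y := a) (d := .right) (q' := moveRight q C.size) rfl ?_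
    have h := runs_moveRight (C := C) q (C.cells g) (a :: L) (codes C ys)
    rw [C.length_cells] at h
    simpa [zmove, leftCells, codes, ← hL] using h
  | left =>
    cases xs with
    | nil =>
      obtain ⟨rfl, rfl⟩ : none = a ∧ List.replicate n none = L := by
        simpa [leftCells, List.replicate_succ] using hL
      exact (Runs.single (y := none) (d := .right) rfl).mono (by omega)
    | cons x xs =>
      obtain ⟨b, r, hr⟩ : ∃ b r, (C.enc x).reverse = b :: r := List.exists_cons_of_ne_nil (by
        simpa [Coding.cells] using C.cells_ne_nil x)
      have hr' : (C.cells x).reverse = some b :: r.map some := by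
        rw [Coding.cells, ← List.map_reverse, hr]
        rfl
      have hrl : r.length = C.size - 1 := by
        have := congrArg List.length hr
        simp [C.length_enc] at this
        omega
      obtain ⟨rfl, rfl⟩ : some b = a ∧ r.map some ++ leftCells C n xs = L := by
        simpa [leftCells, hr'] using hL
      refine .head (y := some b) (d := .stay) (q' := moveLeft q (C.size - 1)) rfl ?_
      have h := runs_moveLeft (C := C) q (r.map some) (leftCells C n xs) (codes C (g :: ys))
        (some b)
      rw [List.length_map, hrl] at h
      have hx : C.cells x = (r.map some).reverse ++ [some b] := by
        rw [← List.reverse_reverse (C.cells x), hr']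
        simp
      simpa [zmove, codes, hx] using h.mono (k' := C.size + 1) (by omega)

/-- Reading and writing a code take `C.size` steps each, and the move takes at most `C.size + 2`. -/
theorem runs_step {q : M.Q} (h₁ : q ≠ M.accept) (h₂ : q ≠ M.reject) (n : ℕ) (xs ys : List M.Γ) :
    (simAuto M C).Runs (3 * C.size + 2) (enter M q) (leftCells C n xs) (codes C ys)
      (enter M (M.δ q (ys.headD M.blank)).1)
      (leftCells C n (zmove (M.δ q (ys.headD M.blank)).2.2 xs
        (M.δ q (ys.headD M.blank)).2.1 ys.tail).1)
      (codes C (zmove (M.δ q (ys.headD M.blank)).2.2 xs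
        (M.δ q (ys.headD M.blank)).2.1 ys.tail).2) := by
  -- Either a code is present under the head, or the codes have ended and `C.size` blank cells play
  -- its role.
  obtain ⟨l, hl, hdec, htape⟩ : ∃ l : List Sym, l.length = C.size ∧
      C.dec M.blank l.reverse = ys.headD M.blank ∧
      tapeOf none (leftCells C n xs) (codes C ys) =
        tapeOf none (leftCells C n xs) (l ++ codes C ys.tail) := by
    cases ys with
    | nil =>
      exact ⟨List.replicate C.size none, by simp, by simpa using C.dec_replicate M.blank,
        by simpa [codes] using (tapeOf_append_replicate (blank := none)
          (leftCells C n xs) [] C.size).symm⟩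
    | cons y ys => exact ⟨C.cells y, C.length_cells y, C.dec_cells _ _, rfl⟩
  obtain ⟨l₀, x, rfl⟩ : ∃ l₀ x, l = l₀ ++ [x] :=
    ⟨_, _, (List.dropLast_append_getLast (List.length_pos_iff.1 (hl ▸ C.size_pos))).symm⟩
  simp only [List.length_append, List.length_singleton] at hl
  set g := ys.headD M.blank with hg
  have hr := runs_readCode (C := C) q l₀ [] x (leftCells C n xs) (codes C ys.tail)
    (by simpa using hl) (g := g) (by simpa using hdec)
  obtain ⟨a, L, hL⟩ : ∃ a L, leftCells C n xs = a :: L := List.exists_cons_of_ne_nil (by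
    simp [leftCells])
  obtain ⟨b, p, hp⟩ : ∃ b p, (C.enc (M.δ q g).2.1).reverse = b :: p :=
    List.exists_cons_of_ne_nil (by simpa [Coding.cells] using C.cells_ne_nil (M.δ q g).2.1)
  have hpl : p.length + 1 = C.size := by
    have := congrArg List.length hp
    simpa [C.length_enc] using this.symm
  have hw := runs_writeCode (C := C) (M.δ q g).1 (M.δ q g).2.2 p l₀.reverse b x a L
    (codes C ys.tail) (by simp; omega)
  have hcode : (b :: p).reverse.map some ++ codes C ys.tail =
      codes C ((M.δ q g).2.1 :: ys.tail) := by
    rw [← hp, List.reverse_reverse]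
    rfl
  rw [hcode] at hw
  rw [hp, hL] at hr
  have hm := runs_move (C := C) (M.δ q g).1 (M.δ q g).2.2 n xs ys.tail (M.δ q g).2.1 hL
  have he : enter M q = readCode q [] := by rw [enter, if_neg h₁, if_neg h₂]
  rw [he]
  refine Runs.congr_left ?_ htape
  rw [hL, List.append_assoc]
  exact ((hr.trans hw).trans hm).mono (by omega)

/-! ### Simulation of a computation -/

theorem length_zmove_add {Γ : Type} (d : Dir) (L : List Γ) (y : Γ) (R : List Γ) :
    (zmove d L y R).1.length + (zmove d L y R).2.length = L.length + R.length + 1 := by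
  cases d with
  | left => cases L <;> simp [zmove]; omega
  | stay => simp [zmove]; omega
  | right => simp [zmove]; omega

theorem enter_verdict (v : Bool) : enter M (if v then M.accept else M.reject) = seekEnd v := by
  cases v with
  | false => simp [enter, M.accept_ne_reject.symm]
  | true => simp [enter]

/-- A step adds at most one code; the resulting length bound limits the later cost of erasing. -/
theorem runs_iterate (n m : ℕ) (q : M.Q) (xs ys : List M.Γ) (v : Bool)
    (h : (M.step^[m] ⟨q, tapeOf M.blank xs ys, xs.length⟩).state =
      if v then M.accept else M.reject) :
    ∃ xs' ys', xs'.length + ys'.length ≤ xs.length + ys.length + m ∧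
      (simAuto M C).Runs (m * (3 * C.size + 2)) (enter M q) (leftCells C n xs) (codes C ys)
        (seekEnd v) (leftCells C n xs') (codes C ys') := by
  induction m generalizing q xs ys with
  | zero =>
    refine ⟨xs, ys, by omega, ?_⟩
    rw [Function.iterate_zero, id] at h
    rw [show q = _ from h, enter_verdict]
    exact .refl
  | succ m ih =>
    rw [Function.iterate_succ_apply] at h
    -- Final configurations are fixed by `step`, so the remaining iterations need no simulation.
    by_cases hq : q = M.accept ∨ q = M.reject
    · rw [TuringMachine.step, if_pos hq] at h
      obtain ⟨xs', ys', hlen, hrun⟩ := ih q xs ys h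
      exact ⟨xs', ys', by omega, hrun.mono (Nat.mul_le_mul_right _ (by omega))⟩
    · rw [not_or] at hq
      rw [M.step_tapeOf hq.1 hq.2] at h
      obtain ⟨xs', ys', hlen, hrun⟩ := ih _ _ _ h
      rw [length_zmove_add, List.length_tail] at hlen
      refine ⟨xs', ys', ?_, ((runs_step (C := C) hq.1 hq.2 n xs ys).trans hrun).mono
        (le_of_eq (by ring))⟩
      omega

end

section

open SimState Auto

variable {M : TuringMachine} {C : Coding M.Γ}

/-! ### Producing the output -/

theorem runs_erase (v : Bool) (n : ℕ) (xs ys : List M.Γ) :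
    (simAuto M C).Runs (2 * (C.size * (xs.length + ys.length)) + 2) (seekEnd v)
      (leftCells C n xs) (codes C ys) (probe v) (List.replicate n none) [none] := by
  -- All coded bits from right to left, as the erasing sweep meets them.
  set B : List Bool := (ys.flatMap C.enc).reverse ++ xs.flatMap fun g => (C.enc g).reverse with hB
  have hy : (ys.flatMap C.enc).length = C.size * ys.length := by
    rw [← length_codes (C := C) ys, codes_eq_map, List.length_map]
  have hx : (xs.flatMap fun g => (C.enc g).reverse).length = C.size * xs.length := by
    induction xs with
    | nil => rfl
    | cons x xs ih =>
      rw [List.flatMap_cons, List.length_append, List.length_reverse, C.length_enc,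
        ih rfl, List.length_cons]
      ring
  have hlen : B.length = C.size * (xs.length + ys.length) := by
    rw [hB, List.length_append, List.length_reverse, hx, hy]
    ring
  have hL : (codes C ys).reverse ++ leftCells C n xs =
      B.map some ++ none :: List.replicate n none := by
    rw [codes_eq_map, hB, leftCells, List.replicate_succ, List.map_append, List.map_reverse,
      List.append_assoc]
    simp [Coding.cells, List.map_flatMap]
  have h₁ := Runs.scan_right (A := simAuto M C) (q := seekEnd v) (fun _ => rfl)
    (ys.flatMap C.enc) (leftCells C n xs) []
  rw [List.append_nil, ← codes_eq_map, hL] at h₁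
  have h₂ : (simAuto M C).Runs (B.length + 1) (seekEnd v)
      (B.map some ++ none :: List.replicate n none) [] (erase v) (List.replicate n none)
      (none :: ((B.map fun _ => none).reverse ++ [none])) :=
    .head (y := none) (d := .left) (q' := erase v) rfl
      (.scan_left (fun _ => none) (fun _ => rfl) _ _ _ _)
  have h₃ : (simAuto M C).Runs 1 (erase v) (List.replicate n none)
      (none :: ((B.map fun _ => none).reverse ++ [none])) (probe v) (List.replicate n none)
      (none :: ((B.map fun _ => none).reverse ++ [none])) :=
    .single (y := none) (d := .stay) rfl
  -- The erased cells are trailing blanks and can be dropped.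
  have h₄ : (none : Sym) :: ((B.map fun _ => none).reverse ++ [none]) =
      [none] ++ List.replicate (B.length + 1) none := by
    simp [List.replicate_succ']
  refine (((h₁.trans h₂).trans h₃).mono ?_).congr_right ?_
  · rw [hy, hlen, mul_add]
    omega
  · rw [h₄, tapeOf_append_replicate]

/-- Off the first cell, the left move reaches a blank; going back, removing the bit and moving left
again makes three steps per cell. -/
theorem runs_probe (v : Bool) (n : ℕ) :
    (simAuto M C).Runs (3 * n) (probe v) (List.replicate n none) [none] (probe v) [] [none] := by
  induction n with
  | zero => exact .refl
  | succ n ih =>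
    refine .head (y := some true) (d := .left) (q' := check v) rfl ?_
    refine .head (y := none) (d := .right) (q' := restore v) rfl ?_
    refine .head (y := none) (d := .left) (q' := probe v) rfl ?_
    exact ih.congr_left (tapeOf_append_replicate _ [none] 1)

/-- On the first cell the left move has no effect, so the bit just written is seen and replaced by
the verdict. -/
theorem halts_probe (v : Bool) (n : ℕ) :
    (simAuto M C).Halts (3 * n + 2) (probe v) (tapeOf none (List.replicate n none) [none])
      (List.replicate n (none : Sym)).length (tapeOf none [] [some v]) 0 := by
  have h : (simAuto M C).Runs 1 (probe v) [] [none] (check v) [] [some true] :=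
    .single (y := some true) (d := .left) rfl
  have h' : (simAuto M C).Halts 1 (check v) (tapeOf none [] [some true]) 0
      (tapeOf none [] [some v]) 0 :=
    halts_single (L := []) (R := [some true]) (y := some v) (d := .stay) rfl
  exact ((runs_probe v n).trans h) _ _ _ h'

theorem halts_simAuto {F : List Bool → Bool} {T : ℕ → ℕ} (hM : M.DecidesInTime F T)
    (w : List Bool) :
    (simAuto M C).Halts (w.length * (2 * w.length + 2 * (C.size * w.length) + 6) + 1 +
        T w.length * (3 * C.size + 2) + (2 * (C.size * (w.length + T w.length)) + 2) +
        (3 * w.length + 2)) load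
      (TapeState.ofList (w.map some)).cells 0 (TapeState.ofList [some (F w)]).cells 0 := by
  obtain ⟨m, hm, hstate⟩ := hM w
  have hstart : M.startCfg w = ⟨M.start, tapeOf M.blank [] (w.map M.bit), ([] : List M.Γ).length⟩ :=
    rfl
  rw [hstart] at hstate
  obtain ⟨xs, ys, hlen, hrun⟩ := runs_iterate (C := C) w.length m _ _ _ _ hstate
  -- The blank after the input serves as the separator, with no codes behind it yet.
  have hload := (runs_load (C := C) (i := 0) (w := w) (E := []) le_rfl).congr_left
    (tapeOf_append_replicate [] (w.map some) 1).symm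
  rw [zero_add] at hload
  have h := ((hload.trans hrun).trans (runs_erase (F w) w.length xs ys)) _ _ _
    (halts_probe (F w) w.length)
  refine h.mono ?_
  have h₁ : m * (3 * C.size + 2) ≤ T w.length * (3 * C.size + 2) := Nat.mul_le_mul_right _ hm
  have h₂ : C.size * (xs.length + ys.length) ≤ C.size * (w.length + T w.length) := by
    refine Nat.mul_le_mul_left _ (hlen.trans ?_)
    simp only [List.length_nil, List.length_map]
    omega
  simp only [List.length_nil, zero_add]
  omega

end

theorem exists_program_of_mem_ClassP {F : List Bool → Bool} (hF : F ∈ ClassP) :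
    ∃ t ∈ TMPrograms, ∃ T ∈ poly, ComputesInTime t (ofDecision F) T := by
  obtain ⟨M, T, hT, hM⟩ := hF
  have := M.finQ
  have := M.finΓ
  have : Nonempty M.Γ := ⟨M.blank⟩
  obtain ⟨C⟩ := exists_coding M.Γ
  obtain ⟨t, ht, hcomp⟩ := exists_program (simAuto M C)
    (SimState.finite_bounded C.size M.Q) (bounded_simAuto M C) (q₀ := .load) trivial
    (F := F) (T := fun n => n * (2 * n + 2 * (C.size * n) + 6) + 1 + T n * (3 * C.size + 2) +
      (2 * (C.size * (n + T n)) + 2) + (3 * n + 2))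
    (fun w => halts_simAuto hM w)
  refine ⟨t, ht, _, ?_, hcomp⟩
  have hc := poly_const
  have hn := poly_id
  -- The factor `4` is the cost of an automaton step in actions; the summands are loading,
  -- simulating, erasing and searching.
  exact poly_mul (hc 4) (poly_add (poly_add (poly_add (poly_add (poly_mul hn (poly_add (poly_add
    (poly_mul (hc 2) hn) (poly_mul (hc 2) (poly_mul (hc C.size) hn))) (hc 6))) (hc 1))
    (poly_mul hT (hc (3 * C.size + 2)))) (poly_add (poly_mul (hc 2) (poly_mul (hc C.size)
    (poly_add hn hT))) (hc 2))) (poly_add (poly_mul (hc 3) hn) (hc 2)))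

end PGA

theorem mainTheorem2 :
    PGA.ClassP =
      {F : List Bool → Bool | ∃ t ∈ PGA.TMPrograms, ∃ T ∈ PGA.poly,
        PGA.ComputesInTime t (PGA.ofDecision F) T} := by
  ext F
  refine ⟨PGA.exists_program_of_mem_ClassP, ?_⟩
  rintro ⟨t, ht, T, hT, h⟩
  exact PGA.mem_ClassP_of_computesInTime ht hT h
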